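/- **Conventions.** A *Brouwer algebra* is a distributive lattice (join $+$, meet $\times$) with least element $0$ and greatest element $1$ in which $a\to b=\min\{c: a+c\ge b\}$ exists for all $a,b$; put $\neg a=a\to 1$. $\mathrm{Th}(\mathfrak L)$ is the set of propositional formulas that take the value $0$ under every valuation in $\mathfrak L$, where $\wedge,\vee,\to,\neg$ are interpreted by $+,\times,\to,\neg$. $\mathfrak L_1$ is *B-embeddable* in $\mathfrak L_2$ if there is an injective lattice homomorphism $\mathfrak L_1\to\mathfrak L_2$ that preserves $0$, $1$ and $\to$. For $a\in\mathfrak L$, the factor $\mathfrak L/a$ is the Brouwer algebra obtained from $\mathfrak L$ by factoring by the principal filter generated by $a$, that is, $b\le c$ in $\mathfrak L/a$ iff $b\times d\le c$ in $\mathfrak L$ for some $d\ge a$ (it is isomorphic to the initial segment $[0,a]$). A *mass problem* is a subset of $\omega^\omega$; $\mathcal A\le_M\mathcal B$ if some partial Turing functional $\Psi$ satisfies $\Psi(f)\in\mathcal A$ for every $f\in\mathcal B$. The degrees of the induced equivalence form the Medvedev lattice $\mathfrak M$, a Brouwer algebra whose operations are induced by $\mathcal A+\mathcal B=\{f\oplus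 g: f\in\mathcal A,\ g\in\mathcal B\}$, $\mathcal A\times\mathcal B=0^\frown\mathcal A\cup 1^\frown\mathcal B$ and $\mathcal A\to\mathcal B=\{z^\frown f: \forall g\in\mathcal A\ \Phi_z(g\oplus f)\in\mathcal B\}$. A *Muchnik degree* is an element of $\mathfrak M$ that contains a mass problem which is upwards closed under Turing reducibility. For $n\ge1$ let $\mathfrak B_n$ be the Brouwer algebra of all upwards closed subsets, ordered by $\supseteq$, of the poset of nonempty subsets of $\{0,\dots,n-1\}$, which is itself ordered by $\supseteq$. Let $\mathsf{LM}=\bigcap_{n\ge1}\mathrm{Th}(\mathfrak B_n)$ be the Medvedev logic of finite problems, and let $\mathsf{KP}$ be the logic obtained from the intuitionistic propositional calculus by adding (all substitution instances of) the formula $(\neg p\to q\vee r)\to(\neg p\to q)\vee(\neg p\to r)$. **Corollary.** There exists a Muchnik degree $\mathbf B_\omega$ such that for every $n\ge 1$ the algebra $\mathfrak B_n$ is B-embeddable in $\mathfrak M/\mathbf B_\omega$. Consequently, for every Muchnik degree $\mathbf B_\omega$ with this property, $$\mathsf{KP}\subseteq \mathrm{Th}(\mathfrak M/\mathbf B_\omega)\subseteq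 \mathsf{LM}.$$ -/

import Mathlib

/-! ### Partial Turing functionals -/

/-- The partial Turing functionals `Ψ`, which take an oracle `g : ℕ → ℕ` to the partial function
`Ψ g`: the smallest class that contains the basic functions and the evaluation of the oracle and is
closed under pairing, composition, primitive recursion and minimization, all of them uniformly in
the oracle (compare `Nat.RecursiveIn`, where the oracle is fixed). -/
inductive TuringFunctional : ((ℕ → ℕ) → ℕ →. ℕ) → Prop
  | zero : TuringFunctional fun _ _ => Part.some 0
  | succ : TuringFunctional fun _ n => Part.some (n + 1)
  | left : TuringFunctional fun _ n => Part.some n.unpair.1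
  | right : TuringFunctional fun _ n => Part.some n.unpair.2
  | oracle : TuringFunctional fun g n => Part.some (g n)
  | pair {F H : (ℕ → ℕ) → ℕ →. ℕ} (hF : TuringFunctional F) (hH : TuringFunctional H) :
      TuringFunctional fun g n => (F g n).bind fun a => (H g n).map fun b => Nat.pair a b
  | comp {F H : (ℕ → ℕ) → ℕ →. ℕ} (hF : TuringFunctional F) (hH : TuringFunctional H) :
      TuringFunctional fun g n => (H g n).bind fun m => F g m
  | prec {F H : (ℕ → ℕ) → ℕ →. ℕ} (hF : TuringFunctional F) (hH : TuringFunctional H) :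
      TuringFunctional fun g p => Nat.rec (motive := fun _ => Part ℕ) (F g p.unpair.1)
        (fun y IH => IH.bind fun i => H g (Nat.pair p.unpair.1 (Nat.pair y i))) p.unpair.2
  | rfind {F : (ℕ → ℕ) → ℕ →. ℕ} (hF : TuringFunctional F) :
      TuringFunctional fun g a =>
        Nat.rfind fun n => (F g (Nat.pair a n)).map fun m => decide (m = 0)

/-- The `e`-th partial Turing functional: to compute `turingPhi e g n`, run the `e`-th partial
recursive function on `n` and longer and longer finite initial segments of the oracle `g`, for more
and more steps, until one of these computations halts. By `turingFunctional_iff` this enumerates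
exactly the partial Turing functionals. -/
def turingPhi (e : ℕ) (g : ℕ → ℕ) : ℕ →. ℕ := fun n =>
  Nat.rfindOpt fun k => Nat.Partrec.Code.evaln k.unpair.1 (Denumerable.ofNat Nat.Partrec.Code e)
    (Nat.pair (Encodable.encode ((List.range k.unpair.2).map g)) n)

namespace TuringFunctional

variable {F G H : (ℕ → ℕ) → ℕ →. ℕ}

theorem of_eq (hF : TuringFunctional F) (h : ∀ g n, F g n = G g n) : TuringFunctional G :=
  (funext fun g => funext fun n => h g n : F = G) ▸ hF

theorem of_partrec {f : ℕ →. ℕ} (hf : Nat.Partrec f) : TuringFunctional fun _ => f := by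
  induction hf with
  | zero => exact zero
  | succ => exact succ
  | left => exact left
  | right => exact right
  | pair _ _ h1 h2 =>
    refine (h1.pair h2).of_eq fun g n => ?_
    simp [Seq.seq, Part.bind_map]
  | comp _ _ h1 h2 => exact h1.comp h2
  | prec _ _ h1 h2 => exact h1.prec h2
  | rfind _ h1 => exact h1.rfind

theorem of_computable {f : ℕ → ℕ} (hf : Computable f) :
    TuringFunctional fun _ n => Part.some (f n) :=
  of_partrec (Partrec.nat_iff.1 hf)

theorem comp_total (hF : TuringFunctional F) {h : (ℕ → ℕ) → ℕ → ℕ}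
    (hh : TuringFunctional fun g n => Part.some (h g n)) :
    TuringFunctional fun g n => F g (h g n) :=
  (hF.comp hh).of_eq fun _ _ => Part.bind_some _ _

theorem comp_computable (hF : TuringFunctional F) {f : ℕ → ℕ} (hf : Computable f) :
    TuringFunctional fun g n => F g (f n) :=
  hF.comp_total (of_computable hf)

theorem pair_total {h k : (ℕ → ℕ) → ℕ → ℕ}
    (hh : TuringFunctional fun g n => Part.some (h g n))
    (hk : TuringFunctional fun g n => Part.some (k g n)) :
    TuringFunctional fun g n => Part.some (Nat.pair (h g n) (k g n)) :=
  (hh.pair hk).of_eq fun g n => by simp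

/-- The finite initial segments of the oracle. -/
theorem initial_segment :
    TuringFunctional fun g n => Part.some (Encodable.encode ((List.range n).map g)) := by
  let c : ℕ → ℕ := fun q => Encodable.encode
    ((Denumerable.ofNat (List ℕ) q.unpair.1) ++ [q.unpair.2])
  have hc : Computable c := by
    refine Primrec.to_comp (Primrec.encode.comp (Primrec.list_concat.comp ?_ ?_))
    · exact (Primrec.ofNat _).comp (Primrec.fst.comp Primrec.unpair)
    · exact Primrec.snd.comp Primrec.unpair
  have hi : Computable fun q : ℕ => q.unpair.2.unpair.2 :=
    (Primrec.snd.comp (Primrec.unpair.comp (Primrec.snd.comp Primrec.unpair))).to_comp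
  have hy : Computable fun q : ℕ => q.unpair.2.unpair.1 :=
    (Primrec.fst.comp (Primrec.unpair.comp (Primrec.snd.comp Primrec.unpair))).to_comp
  have h1 := (of_computable hc).comp_total (pair_total (of_computable hi)
    (oracle.comp_computable hy))
  have hp : Computable fun n : ℕ => Nat.pair 0 n :=
    (Primrec₂.natPair.comp (Primrec.const 0) Primrec.id).to_comp
  refine ((zero.prec h1).comp_computable hp).of_eq fun g n => ?_
  simp only [Nat.unpair_pair]
  induction n with
  | zero => simp
  | succ n ih =>
    change Part.bind _ _ = _
    rw [ih]
    simp [c, List.range_succ]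

/-- The enumeration theorem: `turingPhi e g n` is computable uniformly in `e`, `g` and `n`. -/
theorem universal : TuringFunctional fun g p => turingPhi p.unpair.1 g p.unpair.2 := by
  let v : (ℕ → ℕ) → ℕ → ℕ → Option ℕ := fun g p k =>
    Nat.Partrec.Code.evaln k.unpair.1 (Denumerable.ofNat Nat.Partrec.Code p.unpair.1)
      (Nat.pair (Encodable.encode ((List.range k.unpair.2).map g)) p.unpair.2)
  let w : ℕ → ℕ := fun q => Encodable.encode (Nat.Partrec.Code.evaln q.unpair.1.unpair.2.unpair.1
    (Denumerable.ofNat Nat.Partrec.Code q.unpair.1.unpair.1.unpair.1)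
      (Nat.pair q.unpair.2 q.unpair.1.unpair.1.unpair.2))
  have l : Primrec fun q : ℕ => q.unpair.1 := Primrec.fst.comp Primrec.unpair
  have r : Primrec fun q : ℕ => q.unpair.2 := Primrec.snd.comp Primrec.unpair
  have hw : Computable w := by
    refine Primrec.to_comp (Primrec.encode.comp (Nat.Partrec.Code.primrec_evaln.comp
      (((l.comp (r.comp l)).pair ((Primrec.ofNat _).comp (l.comp (l.comp l)))).pair
      (Primrec₂.natPair.comp r (r.comp (l.comp l))))))
  have hv : TuringFunctional fun g q =>
      Part.some (Encodable.encode (v g q.unpair.1 q.unpair.2)) := by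
    refine ((of_computable hw).comp_total (pair_total (of_computable Computable.id)
      (initial_segment.comp_computable (r.comp r).to_comp))).of_eq fun g q => ?_
    simp [w, v]
  have hs : Computable fun m : ℕ => 1 - m :=
    (Primrec.nat_sub.comp (Primrec.const 1) Primrec.id).to_comp
  have h1 := ((of_computable hs).comp_total hv).rfind
  have hpair : TuringFunctional fun g p => (Nat.rfind fun k => Part.some (v g p k).isSome).map
      fun k => Nat.pair p k := by
    refine ((of_computable Computable.id).pair h1).of_eq fun g p => ?_
    simp only [id, Part.bind_some, Part.map_some, Nat.unpair_pair]
    congr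
    funext k
    cases v g p k <;> simp
  refine ((of_computable (Primrec.pred.to_comp)).comp (hv.comp hpair)).of_eq fun g p => ?_
  have e : turingPhi p.unpair.1 g p.unpair.2 = Nat.rfindOpt (v g p) := rfl
  rw [e]
  ext y
  simp only [Nat.rfindOpt, Part.mem_bind_iff, Part.mem_map_iff]
  constructor
  · rintro ⟨a, ⟨b, ⟨k, hk, rfl⟩, hb⟩, hy⟩
    have hk2 := (Nat.mem_rfind.1 hk).1
    simp only [Nat.unpair_pair, Part.mem_some_iff] at hb hy hk2
    refine ⟨k, hk, ?_⟩
    cases hvk : v g p k with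
    | none => simp [hvk] at hk2
    | some z => subst hb; simp [hvk] at hy; simp [hy]
  · rintro ⟨k, hk, hy⟩
    refine ⟨_, ⟨_, ⟨k, hk, rfl⟩, Part.mem_some _⟩, ?_⟩
    have hv : v g p k = some y := by simpa using hy
    simp [hv]

/-- A Turing functional is determined by a partial recursive function of finite oracle
information. -/
theorem exists_approx (hF : TuringFunctional F) : ∃ φ : List ℕ → ℕ →. ℕ, Partrec₂ φ ∧
    (∀ g n k y, y ∈ φ ((List.range k).map g) n → y ∈ F g n) ∧
    (∀ g n y, y ∈ F g n → ∀ᶠ k in Filter.atTop, y ∈ φ ((List.range k).map g) n) := by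
  induction hF with
  | zero => exact ⟨fun _ _ => Part.some 0, (Computable.const 0), by simp, by simp⟩
  | succ => exact ⟨fun _ n => Part.some (n + 1), (Computable.succ.comp Computable.snd),
      by simp, by simp⟩
  | left => exact ⟨fun _ n => Part.some n.unpair.1,
      (Computable.fst.comp (Computable.unpair.comp Computable.snd)), by simp, by simp⟩
  | right => exact ⟨fun _ n => Part.some n.unpair.2,
      (Computable.snd.comp (Computable.unpair.comp Computable.snd)), by simp, by simp⟩
  | oracle =>
    refine ⟨fun L n => (L[n]? : Option ℕ), ?_, ?_, ?_⟩
    · exact (Primrec.list_getElem?.to_comp).ofOption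
    · intro g n k y hy
      simp only [Part.mem_coe, Option.mem_def, List.getElem?_map, Option.map_eq_some_iff] at hy
      obtain ⟨a, ha, rfl⟩ := hy
      obtain ⟨h, rfl⟩ := List.getElem?_eq_some_iff.1 ha
      simp
    · intro g n y hy
      filter_upwards [Filter.eventually_gt_atTop n] with k hk
      simp only [Part.mem_some_iff] at hy
      simp [hk, hy]
  | pair _ _ h1 h2 =>
    obtain ⟨φ, cφ, sφ, tφ⟩ := h1
    obtain ⟨ψ, cψ, sψ, tψ⟩ := h2
    refine ⟨fun L n => (φ L n).bind fun a => (ψ L n).map fun b => Nat.pair a b, ?_, ?_, ?_⟩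
    · refine Partrec.bind cφ (Partrec.map (Partrec.comp cψ Computable.fst) ?_)
      exact (Primrec₂.natPair.to_comp).comp (Computable.snd.comp Computable.fst) Computable.snd
    · intro g n k y hy
      simp only [Part.mem_bind_iff, Part.mem_map_iff] at hy ⊢
      obtain ⟨a, ha, b, hb, rfl⟩ := hy
      exact ⟨a, sφ _ _ _ _ ha, b, sψ _ _ _ _ hb, rfl⟩
    · intro g n y hy
      simp only [Part.mem_bind_iff, Part.mem_map_iff] at hy ⊢
      obtain ⟨a, ha, b, hb, rfl⟩ := hy
      filter_upwards [tφ _ _ _ ha, tψ _ _ _ hb] with k h h'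
      exact ⟨a, h, b, h', rfl⟩
  | comp _ _ h1 h2 =>
    obtain ⟨φ, cφ, sφ, tφ⟩ := h1
    obtain ⟨ψ, cψ, sψ, tψ⟩ := h2
    refine ⟨fun L n => (ψ L n).bind fun m => φ L m, ?_, ?_, ?_⟩
    · refine Partrec.bind cψ ?_
      exact Partrec₂.comp cφ (Computable.fst.comp Computable.fst) Computable.snd
    · intro g n k y hy
      obtain ⟨a, ha, hb⟩ := Part.mem_bind_iff.1 hy
      exact Part.mem_bind_iff.2 ⟨a, sψ _ _ _ _ ha, sφ _ _ _ _ hb⟩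
    · intro g n y hy
      obtain ⟨a, ha, hb⟩ := Part.mem_bind_iff.1 hy
      filter_upwards [tψ _ _ _ ha, tφ _ _ _ hb] with k h h'
      exact Part.mem_bind_iff.2 ⟨a, h, h'⟩
  | prec _ _ h1 h2 =>
    obtain ⟨φ, cφ, sφ, tφ⟩ := h1
    obtain ⟨ψ, cψ, sψ, tψ⟩ := h2
    refine ⟨fun L p => Nat.rec (motive := fun _ => Part ℕ) (φ L p.unpair.1)
      (fun y IH => IH.bind fun i => ψ L (Nat.pair p.unpair.1 (Nat.pair y i))) p.unpair.2,
      ?_, ?_, ?_⟩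
    · have hl : Computable fun q : List ℕ × ℕ => q.2.unpair.1 :=
        Computable.fst.comp (Computable.unpair.comp Computable.snd)
      have hr : Computable fun q : List ℕ × ℕ => q.2.unpair.2 :=
        Computable.snd.comp (Computable.unpair.comp Computable.snd)
      have hb : Partrec fun q : List ℕ × ℕ => φ q.1 q.2.unpair.1 :=
        Partrec₂.comp cφ Computable.fst hl
      have hst : Partrec₂ fun (q : List ℕ × ℕ) (r : ℕ × ℕ) =>
          ψ q.1 (Nat.pair q.2.unpair.1 (Nat.pair r.1 r.2)) := by
        refine Partrec₂.comp cψ (Computable.fst.comp Computable.fst) ?_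
        exact (Primrec₂.natPair.to_comp).comp (hl.comp Computable.fst)
          ((Primrec₂.natPair.to_comp).comp (Computable.fst.comp Computable.snd)
            (Computable.snd.comp Computable.snd))
      exact Partrec.nat_rec hr hb hst
    · intro g p k
      dsimp only
      induction p.unpair.2 with
      | zero => exact fun y hy => sφ _ _ _ _ hy
      | succ n ih =>
        intro y hy
        simp only [Part.mem_bind_iff] at hy ⊢
        obtain ⟨a, ha, hb⟩ := hy
        exact ⟨a, ih _ ha, sψ _ _ _ _ hb⟩
    · intro g p
      dsimp only
      induction p.unpair.2 with
      | zero => exact fun y hy => tφ _ _ _ hy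
      | succ n ih =>
        intro y hy
        simp only [Part.mem_bind_iff] at hy ⊢
        obtain ⟨a, ha, hb⟩ := hy
        filter_upwards [ih _ ha, tψ _ _ _ hb] with k h h'
        exact ⟨a, h, h'⟩
  | rfind _ h1 =>
    obtain ⟨φ, cφ, sφ, tφ⟩ := h1
    refine ⟨fun L a => Nat.rfind fun n => (φ L (Nat.pair a n)).map fun m => decide (m = 0),
      ?_, ?_, ?_⟩
    · have hp : Partrec₂ fun (q : List ℕ × ℕ) (n : ℕ) =>
          (φ q.1 (Nat.pair q.2 n)).map fun m => decide (m = 0) := by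
        refine Partrec.map (Partrec₂.comp cφ (Computable.fst.comp Computable.fst)
          ((Primrec₂.natPair.to_comp).comp (Computable.snd.comp Computable.fst)
            Computable.snd)) ?_
        exact ((Primrec.eq.comp Primrec.id (Primrec.const 0)).decide.to_comp).comp Computable.snd
      exact Partrec.rfind hp
    · intro g n k y hy
      refine Nat.mem_rfind.2 ?_
      replace hy := Nat.mem_rfind.1 hy
      simp only [Part.mem_map_iff] at hy ⊢
      obtain ⟨⟨m, hm, hm'⟩, h⟩ := hy
      refine ⟨⟨m, sφ _ _ _ _ hm, hm'⟩, fun hlt => ?_⟩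
      obtain ⟨m, hm, hm'⟩ := h hlt
      exact ⟨m, sφ _ _ _ _ hm, hm'⟩
    · intro g n y hy
      replace hy := Nat.mem_rfind.1 hy
      simp only [Part.mem_map_iff] at hy
      obtain ⟨⟨m, hm, hm'⟩, h⟩ := hy
      have h2 : ∀ᶠ k in Filter.atTop, ∀ j ∈ Finset.range y,
          ∃ a ∈ φ ((List.range k).map g) (Nat.pair n j), decide (a = 0) = false := by
        rw [Filter.eventually_all_finset]
        intro j hj
        obtain ⟨a, ha, ha'⟩ := h (Finset.mem_range.1 hj)
        filter_upwards [tφ _ _ _ ha] with k hk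
        exact ⟨a, hk, ha'⟩
      filter_upwards [tφ _ _ _ hm, h2] with k hk hk'
      refine Nat.mem_rfind.2 ?_
      simp only [Part.mem_map_iff]
      exact ⟨⟨m, hk, hm'⟩, fun hlt => hk' _ (Finset.mem_range.2 hlt)⟩

end TuringFunctional

theorem turingFunctional_iff {F : (ℕ → ℕ) → ℕ →. ℕ} :
    TuringFunctional F ↔ ∃ e, F = turingPhi e := by
  constructor
  · intro hF
    obtain ⟨φ, cφ, sφ, tφ⟩ := hF.exists_approx
    have hn : Nat.Partrec fun q => φ (Denumerable.ofNat (List ℕ) q.unpair.1) q.unpair.2 := by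
      refine Partrec.nat_iff.1 (Partrec₂.comp cφ ?_ ?_)
      · exact ((Primrec.ofNat _).comp (Primrec.fst.comp Primrec.unpair)).to_comp
      · exact Computable.snd.comp Computable.unpair
    obtain ⟨c, hc⟩ := Nat.Partrec.Code.exists_code.1 hn
    refine ⟨Encodable.encode c, funext fun g => funext fun n => ?_⟩
    have hs : ∀ y, y ∈ turingPhi (Encodable.encode c) g n → y ∈ F g n := by
      intro y hy
      obtain ⟨k, hk⟩ := Nat.rfindOpt_spec hy
      have := Nat.Partrec.Code.evaln_sound hk
      rw [Denumerable.ofNat_encode, hc] at this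
      exact sφ _ _ k.unpair.2 _ (by simpa using this)
    ext y
    refine ⟨fun hy => ?_, hs y⟩
    have hd : (turingPhi (Encodable.encode c) g n).Dom := by
      obtain ⟨k, hk⟩ := (tφ _ _ _ hy).exists
      have h1 : y ∈ c.eval (Nat.pair (Encodable.encode ((List.range k).map g)) n) := by
        rw [hc]; simpa using hk
      obtain ⟨l, hl⟩ := Nat.Partrec.Code.evaln_complete.1 h1
      refine Nat.rfindOpt_dom.2 ⟨Nat.pair l k, y, ?_⟩
      simpa using hl
    obtain ⟨z, hz⟩ := Part.dom_iff_mem.1 hd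
    rwa [Part.mem_unique hy (hs z hz)]
  · rintro ⟨e, rfl⟩
    have hp : Computable fun n : ℕ => Nat.pair e n :=
      (Primrec₂.natPair.comp (Primrec.const e) Primrec.id).to_comp
    exact (TuringFunctional.universal.comp_computable hp).of_eq fun g n => by simp

namespace TuringFunctional

variable {F G H : (ℕ → ℕ) → ℕ →. ℕ}

theorem ite (hF : TuringFunctional F) (hG : TuringFunctional G) {c : (ℕ → ℕ) → ℕ → ℕ}
    (hc : TuringFunctional fun g n => Part.some (c g n)) :
    TuringFunctional fun g n => if c g n = 0 then F g n else G g n := by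
  obtain ⟨a, rfl⟩ := turingFunctional_iff.1 hF
  obtain ⟨b, rfl⟩ := turingFunctional_iff.1 hG
  have hd : Computable fun m : ℕ => if m = 0 then a else b :=
    (Primrec.ite (Primrec.eq.comp Primrec.id (Primrec.const 0)) (Primrec.const a)
      (Primrec.const b)).to_comp
  refine (universal.comp_total (pair_total ((of_computable hd).comp_total hc)
    (of_computable Computable.id))).of_eq fun g n => ?_
  by_cases h : c g n = 0 <;> simp [h]

/-- Composition of partial functionals. -/
theorem exists_comp (hF : TuringFunctional F) (hH : TuringFunctional H) :
    ∃ K, TuringFunctional K ∧ ∀ g h : ℕ → ℕ, H g = (h : ℕ →. ℕ) → K g = F h := by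
  induction hF with
  | zero => exact ⟨_, zero, fun _ _ _ => rfl⟩
  | succ => exact ⟨_, succ, fun _ _ _ => rfl⟩
  | left => exact ⟨_, left, fun _ _ _ => rfl⟩
  | right => exact ⟨_, right, fun _ _ _ => rfl⟩
  | oracle => exact ⟨_, hH, fun _ _ e => e⟩
  | pair _ _ h1 h2 =>
    obtain ⟨K, hK, eK⟩ := h1
    obtain ⟨M, hM, eM⟩ := h2
    exact ⟨_, hK.pair hM, fun g h e => by simp only [eK g h e, eM g h e]; rfl⟩
  | comp _ _ h1 h2 =>
    obtain ⟨K, hK, eK⟩ := h1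
    obtain ⟨M, hM, eM⟩ := h2
    exact ⟨_, hK.comp hM, fun g h e => by simp only [eK g h e, eM g h e]; rfl⟩
  | prec _ _ h1 h2 =>
    obtain ⟨K, hK, eK⟩ := h1
    obtain ⟨M, hM, eM⟩ := h2
    exact ⟨_, hK.prec hM, fun g h e => by simp only [eK g h e, eM g h e]; rfl⟩
  | rfind _ h1 =>
    obtain ⟨K, hK, eK⟩ := h1
    exact ⟨_, hK.rfind, fun g h e => by simp only [eK g h e]; rfl⟩

end TuringFunctional

/-! ### The Medvedev lattice -/

/-- `f ⊕ g`, with `(f ⊕ g)(2x) = f x` and `(f ⊕ g)(2x+1) = g x`. -/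
def turingJoin (f g : ℕ → ℕ) : ℕ → ℕ := fun n => if n % 2 = 0 then f (n / 2) else g (n / 2)

/-- The concatenation of the one-element string `a` with the infinite string `f`. -/
def stringCons (a : ℕ) (f : ℕ → ℕ) : ℕ → ℕ := fun n => if n = 0 then a else f (n - 1)

/-- A mass problem: a set of functions from `ℕ` to `ℕ`, its solutions. -/
@[ext]
structure MassProblem where
  sol : Set (ℕ → ℕ)

namespace MassProblem

/-- Medvedev reducibility: one partial Turing functional takes every solution of `B` to a solution
of `A`. -/
def Reducible (A B : MassProblem) : Prop :=
  ∃ F, TuringFunctional F ∧ ∀ g ∈ B.sol, ∃ f ∈ A.sol, F g = (f : ℕ →. ℕ)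

instance : Preorder MassProblem where
  le := Reducible
  le_refl A := ⟨_, TuringFunctional.oracle, fun g hg => ⟨g, hg, rfl⟩⟩
  le_trans A B C := by
    rintro ⟨F, hF, hAB⟩ ⟨H, hH, hBC⟩
    obtain ⟨K, hK, e⟩ := hF.exists_comp hH
    refine ⟨K, hK, fun g hg => ?_⟩
    obtain ⟨f, hf, e1⟩ := hBC g hg
    rw [e g f e1]
    exact hAB f hf

/-- The join `A + B`. -/
def join (A B : MassProblem) : MassProblem :=
  ⟨{h | ∃ f ∈ A.sol, ∃ g ∈ B.sol, h = turingJoin f g}⟩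

/-- The meet `A × B`. -/
def meet (A B : MassProblem) : MassProblem :=
  ⟨stringCons 0 '' A.sol ∪ stringCons 1 '' B.sol⟩

/-- The mass problem `A → B`. -/
def imp (A B : MassProblem) : MassProblem :=
  ⟨{h | ∃ z f, h = stringCons z f ∧
    ∀ g ∈ A.sol, ∃ k ∈ B.sol, turingPhi z (turingJoin g f) = (k : ℕ →. ℕ)}⟩

theorem le_join_left (A B : MassProblem) : A ≤ A.join B := by
  have hc : Computable fun n : ℕ => 2 * n :=
    (Primrec.nat_mul.comp (Primrec.const 2) Primrec.id).to_comp
  refine ⟨_, TuringFunctional.oracle.comp_computable hc, ?_⟩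
  rintro _ ⟨f, hf, g, hg, rfl⟩
  refine ⟨f, hf, funext fun n => ?_⟩
  simp [turingJoin]

theorem odd_part : TuringFunctional fun g n => Part.some (g (2 * n + 1)) := by
  have hc : Computable fun n : ℕ => 2 * n + 1 :=
    (Primrec.succ.comp (Primrec.nat_mul.comp (Primrec.const 2) Primrec.id)).to_comp
  exact TuringFunctional.oracle.comp_computable hc

theorem turingJoin_odd (f g : ℕ → ℕ) (n : ℕ) : turingJoin f g (2 * n + 1) = g n := by
  have h1 : (2 * n + 1) % 2 ≠ 0 := by omega
  have h2 : (2 * n + 1) / 2 = n := by omega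
  simp [turingJoin, h2]

theorem le_join_right (A B : MassProblem) : B ≤ A.join B := by
  refine ⟨_, odd_part, ?_⟩
  rintro _ ⟨f, hf, g, hg, rfl⟩
  exact ⟨g, hg, funext fun n => by simp [turingJoin_odd]⟩

theorem join_functional {F G : (ℕ → ℕ) → ℕ →. ℕ} (hF : TuringFunctional F)
    (hG : TuringFunctional G) :
    TuringFunctional fun g n => if n % 2 = 0 then F g (n / 2) else G g (n / 2) := by
  have hm : Computable fun n : ℕ => n % 2 :=
    (Primrec.nat_mod.comp Primrec.id (Primrec.const 2)).to_comp
  have hd : Computable fun n : ℕ => n / 2 :=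
    (Primrec.nat_div.comp Primrec.id (Primrec.const 2)).to_comp
  exact TuringFunctional.ite (hF.comp_computable hd) (hG.comp_computable hd)
    (TuringFunctional.of_computable hm)

theorem join_le {A B C : MassProblem} (hA : A ≤ C) (hB : B ≤ C) : A.join B ≤ C := by
  obtain ⟨F, hF, hAC⟩ := hA
  obtain ⟨G, hG, hBC⟩ := hB
  refine ⟨_, join_functional hF hG, fun g hg => ?_⟩
  obtain ⟨a, ha, ea⟩ := hAC g hg
  obtain ⟨b, hb, eb⟩ := hBC g hg
  refine ⟨_, ⟨a, ha, b, hb, rfl⟩, funext fun n => ?_⟩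
  by_cases h : n % 2 = 0 <;> simp [ea, eb, turingJoin, h]

theorem cons_functional (a : ℕ) : TuringFunctional fun g n => Part.some (stringCons a g n) := by
  refine (TuringFunctional.ite
    (TuringFunctional.of_computable (Computable.const a))
    (TuringFunctional.oracle.comp_computable Primrec.pred.to_comp)
    (TuringFunctional.of_computable Computable.id)).of_eq fun g n => ?_
  by_cases h : n = 0 <;> simp [h, stringCons]

theorem meet_le_left (A B : MassProblem) : A.meet B ≤ A :=
  ⟨_, cons_functional 0, fun g hg => ⟨_, Or.inl ⟨g, hg, rfl⟩, rfl⟩⟩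

theorem meet_le_right (A B : MassProblem) : A.meet B ≤ B :=
  ⟨_, cons_functional 1, fun g hg => ⟨_, Or.inr ⟨g, hg, rfl⟩, rfl⟩⟩

theorem tail_cons (a : ℕ) (f : ℕ → ℕ) (n : ℕ) : stringCons a f (n + 1) = f n := by
  simp [stringCons]

theorem le_meet {A B C : MassProblem} (hA : C ≤ A) (hB : C ≤ B) : C ≤ A.meet B := by
  obtain ⟨F, hF, hCA⟩ := hA
  obtain ⟨G, hG, hCB⟩ := hB
  have ht : TuringFunctional fun g n => Part.some (g (n + 1)) :=
    TuringFunctional.oracle.comp_computable Computable.succ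
  obtain ⟨F', hF', eF⟩ := hF.exists_comp ht
  obtain ⟨G', hG', eG⟩ := hG.exists_comp ht
  refine ⟨_, TuringFunctional.ite hF' hG'
    (TuringFunctional.oracle.comp_computable (Computable.const 0)), ?_⟩
  have tc : ∀ a f, (fun n => Part.some (stringCons a f (n + 1)) : ℕ →. ℕ) = (f : ℕ →. ℕ) :=
    fun a f => funext fun n => by rw [tail_cons]; rfl
  rintro _ (⟨f, hf, rfl⟩ | ⟨f, hf, rfl⟩)
  · obtain ⟨c, hc, e⟩ := hCA f hf
    refine ⟨c, hc, ?_⟩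
    rw [← e, ← eF _ _ (tc 0 f)]
    rfl
  · obtain ⟨c, hc, e⟩ := hCB f hf
    refine ⟨c, hc, ?_⟩
    rw [← e, ← eG _ _ (tc 1 f)]
    rfl

/-- `A → B` is the least `C` with `B ≤ A + C`, up to Medvedev equivalence. -/
theorem imp_le_iff (A B C : MassProblem) : A.imp B ≤ C ↔ B ≤ A.join C := by
  constructor
  · rintro ⟨F, hF, h⟩
    obtain ⟨K, hK, eK⟩ := hF.exists_comp odd_part
    have hev : Computable fun n : ℕ => 2 * n :=
      (Primrec.nat_mul.comp (Primrec.const 2) Primrec.id).to_comp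
    have hJ := join_functional (TuringFunctional.oracle.comp_computable hev)
      (hK.comp_computable Computable.succ)
    obtain ⟨U, hU, eU⟩ := TuringFunctional.universal.exists_comp hJ
    have hR := hU.comp ((hK.comp_computable (Computable.const 0)).pair
      (TuringFunctional.of_computable Computable.id))
    refine ⟨_, hR, ?_⟩
    rintro _ ⟨g, hg, c, hc, rfl⟩
    obtain ⟨_, ⟨z, f, rfl, hz⟩, e⟩ := h c hc
    obtain ⟨k, hk, e2⟩ := hz g hg
    refine ⟨k, hk, ?_⟩
    have e3 : K (turingJoin g c) = (stringCons z f : ℕ →. ℕ) := by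
      rw [eK _ c, e]
      exact funext fun n => by rw [turingJoin_odd]; rfl
    have e4 := eU (turingJoin g c) (turingJoin g f) (by
      funext n
      by_cases hn : n % 2 = 0
      · simp [hn, turingJoin]
      · simp [hn, turingJoin, e3, stringCons])
    funext n
    simp only [e3, e4]
    simp [stringCons, e2]
  · rintro ⟨F, hF, h⟩
    obtain ⟨e, rfl⟩ := turingFunctional_iff.1 hF
    refine ⟨_, cons_functional e, fun c hc => ⟨_, ⟨e, c, rfl, fun g hg => ?_⟩, rfl⟩⟩
    exact h _ ⟨g, hg, c, hc, rfl⟩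

theorem univ_le (A : MassProblem) : (⟨Set.univ⟩ : MassProblem) ≤ A :=
  ⟨_, TuringFunctional.oracle, fun g _ => ⟨g, trivial, rfl⟩⟩

theorem le_empty (A : MassProblem) : A ≤ (⟨∅⟩ : MassProblem) :=
  ⟨_, TuringFunctional.oracle, fun _ hg => hg.elim⟩

end MassProblem

/-- The Medvedev degrees: mass problems up to Medvedev equivalence. -/
def MedvedevDegree : Type := Antisymmetrization MassProblem (· ≤ ·)

namespace MedvedevDegree

instance : PartialOrder MedvedevDegree :=
  inferInstanceAs (PartialOrder (Antisymmetrization MassProblem (· ≤ ·)))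

/-- The Medvedev degree of a mass problem. -/
def deg (A : MassProblem) : MedvedevDegree := toAntisymmetrization (· ≤ ·) A

theorem deg_le_deg {A B : MassProblem} : deg A ≤ deg B ↔ A ≤ B := Iff.rfl

theorem ind {p : MedvedevDegree → Prop} (h : ∀ A, p (deg A)) (a : MedvedevDegree) : p a :=
  Quotient.ind h a

/-- The operation `→` on Medvedev degrees. -/
def imp : MedvedevDegree → MedvedevDegree → MedvedevDegree :=
  Quotient.map₂ MassProblem.imp fun A A' k B B' h =>
    ⟨(MassProblem.imp_le_iff _ _ _).2 (h.1.trans (((MassProblem.imp_le_iff A' B' _).1 le_rfl).trans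
      (MassProblem.join_le (k.2.trans (MassProblem.le_join_left _ _))
        (MassProblem.le_join_right _ _)))),
     (MassProblem.imp_le_iff _ _ _).2 (h.2.trans (((MassProblem.imp_le_iff A B _).1 le_rfl).trans
      (MassProblem.join_le (k.1.trans (MassProblem.le_join_left _ _))
        (MassProblem.le_join_right _ _))))⟩

/-- The Medvedev degrees as a Brouwer algebra. Mathlib writes `b \ a` for `a → b`. -/
instance : CoheytingAlgebra MedvedevDegree where
  sup := Quotient.map₂ MassProblem.join fun _ _ h _ _ k =>
    ⟨MassProblem.join_le (h.1.trans (MassProblem.le_join_left _ _))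
      (k.1.trans (MassProblem.le_join_right _ _)),
     MassProblem.join_le (h.2.trans (MassProblem.le_join_left _ _))
      (k.2.trans (MassProblem.le_join_right _ _))⟩
  le_sup_left := ind fun A => ind fun B => MassProblem.le_join_left A B
  le_sup_right := ind fun A => ind fun B => MassProblem.le_join_right A B
  sup_le := ind fun _ => ind fun _ => ind fun _ h k => MassProblem.join_le h k
  inf := Quotient.map₂ MassProblem.meet fun _ _ h _ _ k =>
    ⟨MassProblem.le_meet ((MassProblem.meet_le_left _ _).trans h.1)
      ((MassProblem.meet_le_right _ _).trans k.1),
     MassProblem.le_meet ((MassProblem.meet_le_left _ _).trans h.2)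
      ((MassProblem.meet_le_right _ _).trans k.2)⟩
  inf_le_left := ind fun A => ind fun B => MassProblem.meet_le_left A B
  inf_le_right := ind fun A => ind fun B => MassProblem.meet_le_right A B
  le_inf := ind fun _ => ind fun _ => ind fun _ h k => MassProblem.le_meet h k
  bot := deg ⟨Set.univ⟩
  bot_le := ind MassProblem.univ_le
  top := deg ⟨∅⟩
  le_top := ind MassProblem.le_empty
  sdiff := fun b a => a.imp b
  sdiff_le_iff := ind fun B => ind fun A => ind fun C => MassProblem.imp_le_iff A B C
  hnot := fun a => a.imp (deg ⟨∅⟩)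
  top_sdiff := ind fun _ => rfl

/-- A Muchnik degree: a Medvedev degree that contains a mass problem which is upwards closed under
Turing reducibility. -/
def IsMuchnik (a : MedvedevDegree) : Prop :=
  ∃ A : MassProblem, deg A = a ∧
    ∀ f ∈ A.sol, ∀ g : ℕ → ℕ, TuringReducible (f : ℕ →. ℕ) (g : ℕ →. ℕ) → g ∈ A.sol

end MedvedevDegree

/-! ### Factors and embeddings of Brouwer algebras -/

section Factor

variable {L : Type*} [CoheytingAlgebra L]

/-- The order that the principal filter generated by `a` induces on `L`. -/
def FactorLE (a b c : L) : Prop := ∃ d, a ≤ d ∧ b ⊓ d ≤ c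

theorem factorLE_iff {a b c : L} : FactorLE a b c ↔ b ⊓ a ≤ c :=
  ⟨fun ⟨_, hd, h⟩ => (inf_le_inf_left b hd).trans h, fun h => ⟨a, le_rfl, h⟩⟩

theorem FactorLE.trans {a b c d : L} (h : FactorLE a b c) (k : FactorLE a c d) :
    FactorLE a b d := by
  rw [factorLE_iff] at *
  exact (le_inf h inf_le_right).trans k

/-- Two elements are identified if each is below the other modulo the filter. -/
def factorSetoid (a : L) : Setoid L where
  r b c := FactorLE a b c ∧ FactorLE a c b
  iseqv :=
    { refl := fun _ => ⟨⟨a, le_rfl, inf_le_left⟩, ⟨a, le_rfl, inf_le_left⟩⟩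
      symm := fun h => ⟨h.2, h.1⟩
      trans := fun h k => ⟨h.1.trans k.1, k.2.trans h.2⟩ }

/-- The factor `L / a` of `L` by the principal filter generated by `a`. -/
def Factor (a : L) : Type _ := Quotient (factorSetoid a)

namespace Factor

variable {a : L}

/-- The class of `b` in `L / a`. -/
def mk (a : L) (b : L) : Factor a := Quotient.mk (factorSetoid a) b

theorem ind {p : Factor a → Prop} (h : ∀ b, p (mk a b)) (x : Factor a) : p x :=
  Quotient.ind h x

instance : LE (Factor a) where
  le := Quotient.lift₂ (FactorLE a) fun _ _ _ _ h k =>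
    propext ⟨fun l => (h.2.trans l).trans k.1, fun l => (h.1.trans l).trans k.2⟩

theorem mk_le_mk {b c : L} : mk a b ≤ mk a c ↔ b ⊓ a ≤ c := factorLE_iff

theorem sup_aux {b c d : L} : (b ⊔ c) ⊓ a ≤ d ↔ b ⊓ a ≤ d ∧ c ⊓ a ≤ d := by
  rw [inf_sup_right, sup_le_iff]

theorem sdiff_aux {b c d : L} : (b ⊓ a) \ c ⊓ a ≤ d ↔ b ⊓ a ≤ c ⊔ d := by
  rw [inf_eq_left.2 (sdiff_le.trans inf_le_right), sdiff_le_iff]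

instance : PartialOrder (Factor a) where
  le_refl := ind fun _ => mk_le_mk.2 inf_le_left
  le_trans := ind fun _ => ind fun _ => ind fun _ h k => FactorLE.trans h k
  le_antisymm := ind fun _ => ind fun _ h k => Quotient.sound ⟨h, k⟩

/-- The operation `→` on the factor: `b → c` is the class of the element `b → c'` of `L`, where
`c' = c ⊓ a` represents the class of `c` in the initial segment below `a`. -/
def imp : Factor a → Factor a → Factor a :=
  Quotient.map₂ (fun b c => (c ⊓ a) \ b) (by
    intro b b' k c c' h
    change FactorLE _ _ _ ∧ FactorLE _ _ _ at h k ⊢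
    simp only [factorLE_iff, sdiff_aux] at *
    have key : ∀ {c c' b b' : L}, c ⊓ a ≤ c' → b' ⊓ a ≤ b → c ⊓ a ≤ b ⊔ (c' ⊓ a) \ b' := by
      intro c c' b b' h k
      have h1 : c ⊓ a ≤ b' ⊔ (c' ⊓ a) \ b' :=
        (le_inf h inf_le_right).trans (sdiff_le_iff.1 le_rfl)
      have h2 := le_inf h1 (inf_le_right : c ⊓ a ≤ a)
      rw [inf_sup_right] at h2
      exact h2.trans (sup_le_sup k inf_le_left)
    exact ⟨key h.1 k.2, key h.2 k.1⟩)

/-- The factor as a Brouwer algebra. -/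
instance : CoheytingAlgebra (Factor a) where
  sup := Quotient.map₂ (· ⊔ ·) (by
    intro b b' h c c' k
    change FactorLE _ _ _ ∧ FactorLE _ _ _ at h k ⊢
    simp only [factorLE_iff, sup_aux] at *
    exact ⟨⟨h.1.trans le_sup_left, k.1.trans le_sup_right⟩,
      ⟨h.2.trans le_sup_left, k.2.trans le_sup_right⟩⟩)
  le_sup_left := ind fun _ => ind fun _ => mk_le_mk.2 (inf_le_left.trans le_sup_left)
  le_sup_right := ind fun _ => ind fun _ => mk_le_mk.2 (inf_le_left.trans le_sup_right)
  sup_le := ind fun _ => ind fun _ => ind fun _ h k =>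
    mk_le_mk.2 (sup_aux.2 ⟨mk_le_mk.1 h, mk_le_mk.1 k⟩)
  inf := Quotient.map₂ (· ⊓ ·) (by
    intro b b' h c c' k
    change FactorLE _ _ _ ∧ FactorLE _ _ _ at h k ⊢
    simp only [factorLE_iff] at *
    exact ⟨le_inf ((inf_le_inf_right a inf_le_left).trans h.1)
        ((inf_le_inf_right a inf_le_right).trans k.1),
      le_inf ((inf_le_inf_right a inf_le_left).trans h.2)
        ((inf_le_inf_right a inf_le_right).trans k.2)⟩)
  inf_le_left := ind fun _ => ind fun _ => mk_le_mk.2 (inf_le_left.trans inf_le_left)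
  inf_le_right := ind fun _ => ind fun _ => mk_le_mk.2 (inf_le_left.trans inf_le_right)
  le_inf := ind fun _ => ind fun _ => ind fun _ h k =>
    mk_le_mk.2 (le_inf (mk_le_mk.1 h) (mk_le_mk.1 k))
  bot := mk a ⊥
  bot_le := ind fun _ => mk_le_mk.2 (inf_le_left.trans bot_le)
  top := mk a ⊤
  le_top := ind fun _ => mk_le_mk.2 le_top
  sdiff := fun y x => imp x y
  sdiff_le_iff := ind fun _ => ind fun _ => ind fun _ =>
    mk_le_mk.trans (sdiff_aux.trans mk_le_mk.symm)
  hnot := fun x => imp x (mk a ⊤)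
  top_sdiff := ind fun _ => rfl

end Factor

end Factor

/-- `L₁` is B-embeddable in `L₂`: there is an injective homomorphism of Brouwer algebras. (A
`CoheytingHom` preserves joins, meets, the greatest element and the implication, and hence also the
least element.) -/
def BEmbeddable (L₁ L₂ : Type*) [CoheytingAlgebra L₁] [CoheytingAlgebra L₂] : Prop :=
  ∃ f : CoheytingHom L₁ L₂, Function.Injective f

/-- The Brouwer algebra of the open (that is, upwards closed) subsets, ordered by `⊇`, of the poset
of nonempty subsets of `{0, …, n-1}`, itself ordered by `⊇`. (Mathlib orders `UpperSet` by `⊇`.) -/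
abbrev MedvedevAlgebra (n : ℕ) : Type := UpperSet ({s : Finset (Fin n) // s.Nonempty}ᵒᵈ)

/-! ### Propositional logics -/

/-- Propositional formulas. -/
inductive PropForm : Type
  | var : ℕ → PropForm
  | and : PropForm → PropForm → PropForm
  | or : PropForm → PropForm → PropForm
  | imp : PropForm → PropForm → PropForm
  | neg : PropForm → PropForm

namespace PropForm

/-- Simultaneous substitution of formulas for the variables. -/
def subst (σ : ℕ → PropForm) : PropForm → PropForm
  | var i => σ i
  | and φ ψ => and (subst σ φ) (subst σ ψ)
  | or φ ψ => or (subst σ φ) (subst σ ψ)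
  | imp φ ψ => imp (subst σ φ) (subst σ ψ)
  | neg φ => neg (subst σ φ)

/-- The value of a formula in a Brouwer algebra: conjunction is the join, disjunction is the meet,
`a → b` is the least `c` with `b ≤ a ⊔ c`, which is `b \ a`, and `¬ a` is `a → 1`. -/
def eval {L : Type*} [CoheytingAlgebra L] (v : ℕ → L) : PropForm → L
  | var i => v i
  | and φ ψ => eval v φ ⊔ eval v ψ
  | or φ ψ => eval v φ ⊓ eval v ψ
  | imp φ ψ => eval v ψ \ eval v φ
  | neg φ => ⊤ \ eval v φ

/-- Derivability in the logic `IPC + Γ`: a Hilbert calculus for intuitionistic propositional logic,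
together with all substitution instances of the formulas in `Γ`. -/
inductive Derivable (Γ : Set PropForm) : PropForm → Prop
  | extra {φ} (σ : ℕ → PropForm) : φ ∈ Γ → Derivable Γ (subst σ φ)
  | mp {φ ψ} : Derivable Γ (imp φ ψ) → Derivable Γ φ → Derivable Γ ψ
  | k (φ ψ) : Derivable Γ (imp φ (imp ψ φ))
  | s (φ ψ χ) : Derivable Γ (imp (imp φ (imp ψ χ)) (imp (imp φ ψ) (imp φ χ)))
  | and_left (φ ψ) : Derivable Γ (imp (and φ ψ) φ)
  | and_right (φ ψ) : Derivable Γ (imp (and φ ψ) ψ)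
  | and_intro (φ ψ) : Derivable Γ (imp φ (imp ψ (and φ ψ)))
  | or_left (φ ψ) : Derivable Γ (imp φ (or φ ψ))
  | or_right (φ ψ) : Derivable Γ (imp ψ (or φ ψ))
  | or_elim (φ ψ χ) : Derivable Γ (imp (imp φ χ) (imp (imp ψ χ) (imp (or φ ψ) χ)))
  | neg_intro (φ ψ) : Derivable Γ (imp (imp φ ψ) (imp (imp φ (neg ψ)) (neg φ)))
  | neg_elim (φ ψ) : Derivable Γ (imp (neg φ) (imp φ ψ))

/-- The Kreisel–Putnam formula `(¬p → q ∨ r) → (¬p → q) ∨ (¬p → r)`. -/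
def kreiselPutnam : PropForm :=
  imp (imp (neg (var 0)) (or (var 1) (var 2)))
    (or (imp (neg (var 0)) (var 1)) (imp (neg (var 0)) (var 2)))

end PropForm

/-- The theory `Th(L)` of a Brouwer algebra: the formulas that take the value `0` (truth) under
every valuation. -/
def BrouwerTheory (L : Type*) [CoheytingAlgebra L] : Set PropForm :=
  {φ | ∀ v : ℕ → L, φ.eval v = ⊥}

/-- The Kreisel–Putnam logic. -/
def LogicKP : Set PropForm := {φ | PropForm.Derivable {PropForm.kreiselPutnam} φ}

/-- The Medvedev logic of finite problems. -/
def LogicLM : Set PropForm := {φ | ∀ n : ℕ, 1 ≤ n → φ ∈ BrouwerTheory (MedvedevAlgebra n)}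

/-!
Let `D` be upwards closed, and let a functional `Ψ` reduce `X × Y` to `D + C`. For a solution `c` of
`C`, some finite string `s` makes `Ψ` choose its branch on `s⌢g ⊕ c` before it reads any of `g`, and
such an `s` can be found computably from `c`. As `s⌢g` is a solution of `D` whenever `g` is, the
branch depends on `c` alone, so `c` computes a solution of `(D → X) × (D → Y)`. Hence
`D → X × Y = (D → X) × (D → Y)` for every Muchnik degree `D`, and since `⊥` is meet-prime, so is
`D`. Both properties pass to factors, and the first one is the Kreisel–Putnam law, because an
implication with a Muchnik degree as its conclusion is again a Muchnik degree.

By the Baire category theorem there are functions `h i` that are pairwise incomparable under Turing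
reducibility. Sending a set `S` of indices to the degree of the functions computable from no `h i`
with `i ∈ S` embeds a Boolean algebra into a factor of the Medvedev lattice. An element of
`MedvedevAlgebra n` is a simplicial complex, that is, a union of simplices; unions are meets, so the
embedding extends to complexes. The extension preserves `→` by the first property of Muchnik
degrees, and it is injective because they are meet-prime.
-/

open Encodable Denumerable
open scoped Computability

/-! ### Turing functionals and Turing reducibility -/

namespace TuringFunctional

variable {F : (ℕ → ℕ) → ℕ →. ℕ}

theorem recursiveIn (hF : TuringFunctional F) (g : ℕ → ℕ) :
    Nat.RecursiveIn {(g : ℕ →. ℕ)} (F g) := by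
  induction hF with
  | zero => exact .zero
  | succ => exact .succ
  | left => exact .left
  | right => exact .right
  | oracle => exact .oracle _ rfl
  | pair _ _ hF hH => exact (hF.pair hH).of_eq fun n => by simp [Seq.seq, Part.bind_map]
  | comp _ _ hF hH => exact hF.comp hH
  | prec _ _ hF hH => exact hF.prec hH
  | rfind _ hF => exact hF.rfind

theorem exists_of_recursiveIn {f : ℕ →. ℕ} {g : ℕ → ℕ}
    (hf : Nat.RecursiveIn {(g : ℕ →. ℕ)} f) : ∃ F, TuringFunctional F ∧ F g = f := by
  induction hf with
  | zero => exact ⟨_, .zero, rfl⟩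
  | succ => exact ⟨_, .succ, rfl⟩
  | left => exact ⟨_, .left, rfl⟩
  | right => exact ⟨_, .right, rfl⟩
  | oracle _ hk => exact ⟨_, .oracle, (Set.mem_singleton_iff.1 hk).symm⟩
  | pair _ _ ihF ihH =>
    obtain ⟨F, hF, rfl⟩ := ihF
    obtain ⟨H, hH, rfl⟩ := ihH
    exact ⟨_, hF.pair hH, funext fun n => by simp [Seq.seq, Part.bind_map]⟩
  | comp _ _ ihF ihH =>
    obtain ⟨F, hF, rfl⟩ := ihF
    obtain ⟨H, hH, rfl⟩ := ihH
    exact ⟨_, hF.comp hH, rfl⟩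
  | prec _ _ ihF ihH =>
    obtain ⟨F, hF, rfl⟩ := ihF
    obtain ⟨H, hH, rfl⟩ := ihH
    exact ⟨_, hF.prec hH, rfl⟩
  | rfind _ ihF =>
    obtain ⟨F, hF, rfl⟩ := ihF
    exact ⟨_, hF.rfind, rfl⟩

end TuringFunctional

theorem turingReducible_iff_exists_turingFunctional {f : ℕ →. ℕ} {g : ℕ → ℕ} :
    f ≤ᵀ (g : ℕ →. ℕ) ↔ ∃ F, TuringFunctional F ∧ F g = f := by
  rw [TuringReducible, RecursiveIn.iff_nat]
  exact ⟨TuringFunctional.exists_of_recursiveIn, fun ⟨_, hF, e⟩ => e ▸ hF.recursiveIn g⟩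

namespace TuringFunctional

variable {F : (ℕ → ℕ) → ℕ →. ℕ}

theorem turingReducible (hF : TuringFunctional F) {f g : ℕ → ℕ} (e : F g = (f : ℕ →. ℕ)) :
    (f : ℕ →. ℕ) ≤ᵀ (g : ℕ →. ℕ) :=
  turingReducible_iff_exists_turingFunctional.2 ⟨F, hF, e⟩

theorem comp_oracle (hF : TuringFunctional F) {Γ : (ℕ → ℕ) → ℕ → ℕ}
    (hΓ : TuringFunctional fun g n => Part.some (Γ g n)) :
    TuringFunctional fun g => F (Γ g) := by
  obtain ⟨K, hK, e⟩ := hF.exists_comp hΓ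
  exact hK.of_eq fun g n => by rw [e g (Γ g) rfl]

end TuringFunctional

theorem turingJoin_even (f g : ℕ → ℕ) (n : ℕ) : turingJoin f g (2 * n) = f n := by
  simp [turingJoin]

theorem TuringFunctional.even_part : TuringFunctional fun g n => Part.some (g (2 * n)) :=
  oracle.comp_computable (Primrec.nat_double.to_comp)

theorem left_turingReducible_turingJoin (f g : ℕ → ℕ) :
    (f : ℕ →. ℕ) ≤ᵀ (turingJoin f g : ℕ →. ℕ) :=
  TuringFunctional.even_part.turingReducible (funext fun n => by simp [turingJoin_even])

theorem right_turingReducible_turingJoin (f g : ℕ → ℕ) :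
    (g : ℕ →. ℕ) ≤ᵀ (turingJoin f g : ℕ →. ℕ) :=
  MassProblem.odd_part.turingReducible (funext fun n => by simp [MassProblem.turingJoin_odd])

theorem turingJoin_turingReducible_iff {f g h : ℕ → ℕ} :
    (turingJoin f g : ℕ →. ℕ) ≤ᵀ (h : ℕ →. ℕ) ↔
      (f : ℕ →. ℕ) ≤ᵀ (h : ℕ →. ℕ) ∧ (g : ℕ →. ℕ) ≤ᵀ (h : ℕ →. ℕ) := by
  refine ⟨fun hfg => ⟨(left_turingReducible_turingJoin f g).trans hfg,
    (right_turingReducible_turingJoin f g).trans hfg⟩, fun ⟨hf, hg⟩ => ?_⟩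
  obtain ⟨F, hF, eF⟩ := turingReducible_iff_exists_turingFunctional.1 hf
  obtain ⟨G, hG, eG⟩ := turingReducible_iff_exists_turingFunctional.1 hg
  refine (MassProblem.join_functional hF hG).turingReducible (funext fun n => ?_)
  by_cases hn : n % 2 = 0 <;> simp [eF, eG, turingJoin, hn]

/-! ### An antichain of Turing degrees -/

theorem TuringFunctional.isOpen_setOf_mem {F : (ℕ → ℕ) → ℕ →. ℕ} (hF : TuringFunctional F)
    (n y : ℕ) : IsOpen {g | y ∈ F g n} := by
  obtain ⟨φ, -, sound, complete⟩ := hF.exists_approx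
  refine isOpen_iff_mem_nhds.2 fun g hg => ?_
  obtain ⟨k, hk⟩ := (complete g n y hg).exists
  filter_upwards [(PiNat.isOpen_cylinder _ g k).mem_nhds (PiNat.self_mem_cylinder g k)] with g' hg'
  refine sound g' n k y ?_
  rwa [List.map_congr_left fun i hi => PiNat.mem_cylinder_iff.1 hg' i (List.mem_range.1 hi)]

/-- A family of total functions no two of which are Turing comparable. -/
def IsTuringAntichain {ι : Type*} (h : ι → ℕ → ℕ) : Prop :=
  Pairwise fun i j => ¬ (h i : ℕ →. ℕ) ≤ᵀ (h j : ℕ →. ℕ)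

section Antichain

open Filter Set Topology

variable {ι : Type*} {F : (ℕ → ℕ) → ℕ →. ℕ}

theorem TuringFunctional.isClosed_setOf_forall_mem_eq (hF : TuringFunctional F) (i j : ι) :
    IsClosed {x : ι → ℕ → ℕ | ∀ n, ∀ y ∈ F (x j) n, y = x i n} := by
  simp only [ofPred_forall]
  refine isClosed_iInter fun n => isClosed_iInter fun y => isClosed_imp ?_ ?_
  · exact (hF.isOpen_setOf_mem n y).preimage (continuous_apply (A := fun _ => ℕ → ℕ) j)
  · exact isClosed_eq continuous_const ((continuous_apply n).comp (continuous_apply i))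

theorem tendsto_update_update_succ [DecidableEq ι] (x : ι → ℕ → ℕ) (i : ι) :
    Tendsto (fun m => Function.update x i (Function.update (x i) m (x i m + 1))) atTop (𝓝 x) := by
  have h : Tendsto (fun m => Function.update (x i) m (x i m + 1)) atTop (𝓝 (x i)) := by
    refine tendsto_pi_nhds.2 fun n => tendsto_const_nhds.congr' ?_
    filter_upwards [eventually_gt_atTop n] with m hm
    rw [Function.update_of_ne hm.ne]
  simpa using (tendsto_const_nhds (x := x)).update i h

theorem TuringFunctional.isNowhereDense_setOf_eq (hF : TuringFunctional F) {i j : ι}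
    (hij : i ≠ j) : IsNowhereDense {x : ι → ℕ → ℕ | F (x j) = (x i : ℕ →. ℕ)} := by
  classical
  set R := {x : ι → ℕ → ℕ | F (x j) = (x i : ℕ →. ℕ)}
  have hR : closure R ⊆ {x | ∀ n, ∀ y ∈ F (x j) n, y = x i n} := by
    refine closure_minimal (fun x hx n y hy => ?_) (hF.isClosed_setOf_forall_mem_eq i j)
    simpa [show F (x j) = x i from hx] using hy
  refine eq_empty_of_forall_notMem fun x hx => ?_
  obtain ⟨x, hxU, hxR⟩ := mem_closure_iff.1 (interior_subset hx) _ isOpen_interior hx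
  -- Changing a single value of `x i`, far out, stays in the open set and leaves `F (x j)` as it is.
  obtain ⟨m, hm⟩ := ((tendsto_update_update_succ x i).eventually
    (isOpen_interior.mem_nhds hxU)).exists
  have := hR (interior_subset hm) m (x i m)
  simp [hij.symm, show F (x j) = x i from hxR] at this

theorem exists_isTuringAntichain (ι : Type*) [Countable ι] :
    ∃ h : ι → ℕ → ℕ, IsTuringAntichain h := by
  let R (p : {p : ι × ι // p.1 ≠ p.2} × ℕ) : Set (ι → ℕ → ℕ) :=
    {x | turingPhi p.2 (x p.1.1.2) = (x p.1.1.1 : ℕ →. ℕ)}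
  have hR : IsMeagre (⋃ p, R p) := isMeagre_iUnion fun p =>
    ((turingFunctional_iff.2 ⟨p.2, rfl⟩).isNowhereDense_setOf_eq p.1.2).isMeagre
  obtain ⟨h, hh⟩ : (⋃ p, R p)ᶜ.Nonempty := (dense_of_mem_residual hR).nonempty
  refine ⟨h, fun i j hij hred => hh ?_⟩
  obtain ⟨F, hF, e⟩ := turingReducible_iff_exists_turingFunctional.1 hred
  obtain ⟨c, rfl⟩ := turingFunctional_iff.1 hF
  exact mem_iUnion.2 ⟨⟨⟨(i, j), hij⟩, c⟩, e⟩

end Antichain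

/-! ### Upwards closed mass problems -/

namespace MassProblem

/-- A mass problem that is upwards closed under Turing reducibility; the Muchnik degrees are the
Medvedev degrees of such problems. -/
def IsUpwardClosed (A : MassProblem) : Prop :=
  ∀ f ∈ A.sol, ∀ g : ℕ → ℕ, (f : ℕ →. ℕ) ≤ᵀ (g : ℕ →. ℕ) → g ∈ A.sol

theorem le_of_sol_subset {A B : MassProblem} (h : B.sol ⊆ A.sol) : A ≤ B :=
  ⟨_, .oracle, fun g hg => ⟨g, h hg, rfl⟩⟩

theorem IsUpwardClosed.le_iff {A B : MassProblem} (hA : A.IsUpwardClosed) :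
    A ≤ B ↔ B.sol ⊆ A.sol := by
  refine ⟨fun ⟨F, hF, h⟩ g hg => ?_, le_of_sol_subset⟩
  obtain ⟨f, hf, e⟩ := h g hg
  exact hA f hf g (hF.turingReducible e)

/-- The Muchnik implication: the functions that solve `B` jointly with any solution of `A`. -/
def muchnikImp (A B : MassProblem) : MassProblem := ⟨{f | ∀ g ∈ A.sol, turingJoin g f ∈ B.sol}⟩

theorem IsUpwardClosed.muchnikImp (A : MassProblem) {B : MassProblem} (hB : B.IsUpwardClosed) :
    (A.muchnikImp B).IsUpwardClosed := fun _ hf k hfk g hg =>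
  hB _ (hf g hg) _ (turingJoin_turingReducible_iff.2 ⟨left_turingReducible_turingJoin g k,
    hfk.trans (right_turingReducible_turingJoin g k)⟩)

theorem IsUpwardClosed.muchnikImp_le_iff (A : MassProblem) {B : MassProblem}
    (hB : B.IsUpwardClosed) (C : MassProblem) : A.muchnikImp B ≤ C ↔ B ≤ A.join C := by
  rw [(hB.muchnikImp A).le_iff, hB.le_iff]
  constructor
  · rintro h _ ⟨g, hg, f, hf, rfl⟩
    exact h hf g hg
  · exact fun h f hf g hg => h ⟨g, hg, f, hf, rfl⟩

end MassProblem

theorem MedvedevDegree.IsMuchnik.sdiff {b : MedvedevDegree} (hb : b.IsMuchnik)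
    (a : MedvedevDegree) : (b \ a).IsMuchnik := by
  obtain ⟨B, rfl, hB⟩ := hb
  induction a using MedvedevDegree.ind with
  | h A =>
  have hB : B.IsUpwardClosed := hB
  refine ⟨A.muchnikImp B, ?_, hB.muchnikImp A⟩
  refine eq_of_forall_ge_iff fun c => ?_
  induction c using MedvedevDegree.ind with
  | h C => exact (hB.muchnikImp_le_iff A C).trans (MassProblem.imp_le_iff A B C).symm

/-! ### Searching for a halting computation -/

namespace TuringFunctional

variable {F : (ℕ → ℕ) → ℕ →. ℕ}

theorem exists_stage (hF : TuringFunctional F) : ∃ t : (ℕ → ℕ) → ℕ → ℕ,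
    (TuringFunctional fun g p => Part.some (t g p)) ∧
      ∀ g n, (F g n).Dom ↔ ∃ k, t g (Nat.pair n k) = 0 := by
  obtain ⟨e, rfl⟩ := turingFunctional_iff.1 hF
  let halted (p : ℕ) (x : ℕ) : ℕ := 1 - encode (Nat.Partrec.Code.evaln p.unpair.2.unpair.1
    (ofNat Nat.Partrec.Code e) (Nat.pair x p.unpair.1))
  have halted_computable : Computable fun q : ℕ => halted q.unpair.1 q.unpair.2 := by
    have l : Primrec fun q : ℕ => q.unpair.1 := Primrec.fst.comp Primrec.unpair
    have r : Primrec fun q : ℕ => q.unpair.2 := Primrec.snd.comp Primrec.unpair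
    refine (Primrec.nat_sub.comp (Primrec.const 1) (Primrec.encode.comp
      (Nat.Partrec.Code.primrec_evaln.comp (((l.comp (r.comp l)).pair (Primrec.const _)).pair
        (Primrec₂.natPair.comp r (l.comp l)))))).to_comp
  have length_computable : Computable fun p : ℕ => p.unpair.2.unpair.2 := Primrec.to_comp <|
    Primrec.snd.comp <| Primrec.unpair.comp <| Primrec.snd.comp Primrec.unpair
  refine ⟨fun g p => halted p (encode ((List.range p.unpair.2.unpair.2).map g)), ?_, fun g n => ?_⟩
  · exact ((of_computable halted_computable).comp_total (pair_total (of_computable Computable.id)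
      (initial_segment.comp_computable length_computable))).of_eq fun g p => by simp
  · simp only [turingPhi, Nat.rfindOpt_dom, halted, Nat.unpair_pair]
    refine exists_congr fun k => ?_
    cases Nat.Partrec.Code.evaln k.unpair.1 (ofNat Nat.Partrec.Code e)
      (Nat.pair (encode ((List.range k.unpair.2).map g)) n) <;> simp

theorem exists_selection (hF : TuringFunctional F) : ∃ S, TuringFunctional S ∧
    ∀ g n, (∃ m, (F g (Nat.pair n m)).Dom) → ∃ m ∈ S g n, (F g (Nat.pair n m)).Dom := by
  obtain ⟨t, ht, dom_iff⟩ := hF.exists_stage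
  let arrange (q : ℕ) : ℕ :=
    Nat.pair (Nat.pair q.unpair.1 q.unpair.2.unpair.1) q.unpair.2.unpair.2
  have l : Primrec fun q : ℕ => q.unpair.1 := Primrec.fst.comp Primrec.unpair
  have r : Primrec fun q : ℕ => q.unpair.2 := Primrec.snd.comp Primrec.unpair
  have arrange_computable : Computable arrange := Primrec.to_comp <|
    Primrec₂.natPair.comp (Primrec₂.natPair.comp l (l.comp r)) (r.comp r)
  refine ⟨_, (of_computable l.to_comp).comp (ht.comp_computable arrange_computable).rfind,
    fun g n ⟨m, hm⟩ => ?_⟩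
  obtain ⟨k, hk⟩ := (dom_iff g _).1 hm
  have found : ∃ p, t g (arrange (Nat.pair n p)) = 0 := ⟨Nat.pair m k, by simpa [arrange] using hk⟩
  refine ⟨(Nat.find found).unpair.1, ?_, (dom_iff g _).2 ⟨(Nat.find found).unpair.2, ?_⟩⟩
  · refine Part.mem_bind_iff.2 ⟨Nat.find found, Nat.mem_rfind.2 ⟨?_, fun hp => ?_⟩, by simp⟩
    · simpa using Nat.find_spec found
    · simpa using Nat.find_min found hp
  · simpa [arrange] using Nat.find_spec found

end TuringFunctional

/-- The initial segment of `f ⊕ g` determined by the initial segments `s` of `f` and `t` of `g`,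
which are meant to have the same length. -/
def interleave (s t : List ℕ) : List ℕ :=
  (List.range (2 * s.length)).map (turingJoin (s.getD · 0) (t.getD · 0))

theorem primrec_interleave : Primrec₂ interleave := by
  have half : Primrec fun q : (List ℕ × List ℕ) × ℕ => q.2 / 2 :=
    Primrec.nat_div.comp Primrec.snd (Primrec.const 2)
  refine Primrec.list_map (Primrec.list_range.comp (Primrec.nat_mul.comp (Primrec.const 2)
    (Primrec.list_length.comp Primrec.fst))) (Primrec.ite ?_ ?_ ?_)
  · exact Primrec.eq.comp (Primrec.nat_mod.comp Primrec.snd (Primrec.const 2)) (Primrec.const 0)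
  · exact (Primrec.list_getD 0).comp (Primrec.fst.comp Primrec.fst) half
  · exact (Primrec.list_getD 0).comp (Primrec.snd.comp Primrec.fst) half

theorem interleave_map_range (f g : ℕ → ℕ) (k : ℕ) :
    interleave ((List.range k).map f) ((List.range k).map g) =
      (List.range (2 * k)).map (turingJoin f g) := by
  simp only [interleave, List.length_map, List.length_range]
  refine List.map_congr_left fun i hi => ?_
  have hk : i / 2 < k := by have := List.mem_range.1 hi; omega
  simp [turingJoin, List.getD, hk]

/-- The infinite string that starts with the finite string `s` and continues with `f`. -/
def stringAppend (s : List ℕ) (f : ℕ → ℕ) : ℕ → ℕ := fun n => s[n]?.getD (f (n - s.length))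

theorem map_stringAppend_range (s : List ℕ) (f : ℕ → ℕ) :
    (List.range s.length).map (stringAppend s f) = s :=
  List.ext_getElem (by simp) fun i _ hi => by simp [stringAppend, hi]

theorem turingReducible_stringAppend (s : List ℕ) (f : ℕ → ℕ) :
    (f : ℕ →. ℕ) ≤ᵀ (stringAppend s f : ℕ →. ℕ) := by
  have shift : Computable fun n : ℕ => n + s.length :=
    (Primrec.nat_add.comp Primrec.id (Primrec.const _)).to_comp
  exact (TuringFunctional.oracle.comp_computable shift).turingReducible
    (funext fun n => by simp [stringAppend])

namespace TuringFunctional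

variable {F H : (ℕ → ℕ) → ℕ →. ℕ}

theorem exists_string_search (hF : TuringFunctional F) :
    ∃ S T, TuringFunctional S ∧ TuringFunctional T ∧
      ∀ h n, (∃ g, (F (turingJoin g h) n).Dom) → ∃ s : List ℕ, encode s ∈ S h n ∧
        ∃ y ∈ T h n, ∀ f, y ∈ F (turingJoin (stringAppend s f) h) n := by
  obtain ⟨φ, φ_partrec, sound, complete⟩ := hF.exists_approx
  let E (h : ℕ → ℕ) (p : ℕ) : Part ℕ :=
    let s := ofNat (List ℕ) p.unpair.2
    φ (interleave s ((List.range s.length).map h)) p.unpair.1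
  have l : Primrec fun q : ℕ => q.unpair.1 := Primrec.fst.comp Primrec.unpair
  have string : Primrec fun p : ℕ => ofNat (List ℕ) p.unpair.2 :=
    (Primrec.ofNat _).comp (Primrec.snd.comp Primrec.unpair)
  have hE : TuringFunctional E := by
    have φ_interleave_partrec : Nat.Partrec fun q =>
        φ (interleave (ofNat (List ℕ) q.unpair.1.unpair.2) (ofNat (List ℕ) q.unpair.2))
          q.unpair.1.unpair.1 :=
      Partrec.nat_iff.1 (Partrec₂.comp φ_partrec
        (primrec_interleave.comp (string.comp l) string).to_comp (l.comp l).to_comp)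
    refine ((of_partrec φ_interleave_partrec).comp_total (pair_total (of_computable Computable.id)
      (initial_segment.comp_computable (Primrec.list_length.comp string).to_comp))).of_eq
        fun h p => by simp [E]
  obtain ⟨S, hS, selects⟩ := hE.exists_selection
  refine ⟨S, _, hS, hE.comp ((of_computable Computable.id).pair hS), fun h n ⟨g, hg⟩ => ?_⟩
  obtain ⟨z, hz⟩ := Part.dom_iff_mem.1 hg
  obtain ⟨k, hk⟩ := Filter.eventually_atTop.1 (complete _ _ _ hz)
  obtain ⟨m, hm, hdom⟩ := selects h n ⟨encode ((List.range k).map g), Part.dom_iff_mem.2 ⟨z, by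
    simpa [E, interleave_map_range] using hk (2 * k) (by omega)⟩⟩
  obtain ⟨y, hy⟩ := Part.dom_iff_mem.1 hdom
  refine ⟨ofNat (List ℕ) m, by simpa using hm, y, ?_, fun f => sound _ n
    (2 * (ofNat (List ℕ) m).length) y ?_⟩
  · exact Part.mem_bind_iff.2 ⟨Nat.pair n m, by simpa using hm, hy⟩
  · rw [← interleave_map_range, map_stringAppend_range]
    simpa [E] using hy

theorem exists_cons (hF : TuringFunctional F) (hH : TuringFunctional H) :
    ∃ K, TuringFunctional K ∧ ∀ g f : ℕ → ℕ, ∀ a ∈ F g 0, H g = (f : ℕ →. ℕ) →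
      K g = (stringCons a f : ℕ →. ℕ) := by
  refine ⟨_, TuringFunctional.ite (hF.comp_computable (Computable.const 0))
    (hH.comp_computable Primrec.pred.to_comp) (of_computable Computable.id), ?_⟩
  intro g f a ha e
  funext n
  by_cases hn : n = 0 <;> simp [hn, stringCons, e, Part.eq_some_iff.2 ha]

-- The oracle is `w = g ⊕ s⌢k`, so that `w 1` is the code of the finite string `s`.
theorem prepend_string : TuringFunctional fun w n => Part.some
    (turingJoin (stringAppend (ofNat (List ℕ) (w 1)) (fun m => w (2 * m)))
      (fun m => w (2 * m + 3)) n) := by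
  let entry (q : ℕ) : ℕ :=
    (ofNat (List ℕ) q.unpair.1.unpair.1)[q.unpair.1.unpair.2]?.getD q.unpair.2
  let position (q : ℕ) : ℕ := 2 * (q.unpair.2 - (ofNat (List ℕ) q.unpair.1).length)
  have l : Primrec fun q : ℕ => q.unpair.1 := Primrec.fst.comp Primrec.unpair
  have r : Primrec fun q : ℕ => q.unpair.2 := Primrec.snd.comp Primrec.unpair
  have entry_computable : Computable entry := Primrec.to_comp <| Primrec.option_getD.comp
    (Primrec.list_getElem?.comp ((Primrec.ofNat _).comp (l.comp l)) (r.comp l)) r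
  have position_computable : Computable position := Primrec.to_comp <| Primrec.nat_double.comp <|
    Primrec.nat_sub.comp r (Primrec.list_length.comp ((Primrec.ofNat _).comp l))
  have odd_computable : Computable fun n : ℕ => 2 * n + 3 := Primrec.to_comp <|
    Primrec.nat_add.comp Primrec.nat_double (Primrec.const 3)
  have code_and_input : TuringFunctional fun w n => Part.some (Nat.pair (w 1) n) :=
    (oracle.comp_computable (Computable.const 1)).pair_total (of_computable Computable.id)
  have append := (of_computable entry_computable).comp_total (code_and_input.pair_total
    (oracle.comp_total ((of_computable position_computable).comp_total code_and_input)))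
  refine (MassProblem.join_functional append (oracle.comp_computable odd_computable)).of_eq
    fun w n => ?_
  by_cases hn : n % 2 = 0 <;> simp [turingJoin, stringAppend, entry, position, hn]

-- The string is part of the oracle because a single index `e` has to serve all strings.
theorem exists_prepend_index (hF : TuringFunctional F) : ∃ e, ∀ (s : List ℕ) (g k : ℕ → ℕ) (n : ℕ),
    turingPhi e (turingJoin g (stringCons (encode s) k)) n =
      F (turingJoin (stringAppend s g) k) (n + 1) := by
  obtain ⟨e, he⟩ := turingFunctional_iff.1
    ((hF.comp_oracle prepend_string).comp_computable Computable.succ)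
  refine ⟨e, fun s g k n => ?_⟩
  have head : turingJoin g (stringCons (encode s) k) 1 = encode s :=
    MassProblem.turingJoin_odd _ _ 0
  have tail (m : ℕ) : turingJoin g (stringCons (encode s) k) (2 * m + 3) = k m :=
    MassProblem.turingJoin_odd _ _ (m + 1)
  simp only [← he, head, tail, turingJoin_even, ofNat_encode, Nat.succ_eq_add_one]

end TuringFunctional

/-! ### Muchnik degrees as premises -/

namespace MassProblem

theorem mem_meet_sol_iff {A B : MassProblem} {f : ℕ → ℕ} : f ∈ (A.meet B).sol ↔
    f 0 = 0 ∧ (fun n => f (n + 1)) ∈ A.sol ∨ f 0 = 1 ∧ (fun n => f (n + 1)) ∈ B.sol := by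
  have stringCons_tail {a : ℕ} (ha : f 0 = a) : stringCons a (fun n => f (n + 1)) = f := by
    funext n
    cases n <;> simp [stringCons, ha]
  constructor
  · rintro (⟨f, hf, rfl⟩ | ⟨f, hf, rfl⟩)
    · exact Or.inl ⟨rfl, hf⟩
    · exact Or.inr ⟨rfl, hf⟩
  · rintro (⟨ha, hf⟩ | ⟨ha, hf⟩)
    · exact Or.inl ⟨_, hf, stringCons_tail ha⟩
    · exact Or.inr ⟨_, hf, stringCons_tail ha⟩

theorem IsUpwardClosed.meet_imp_le_of_meet_le_join {D Q R C : MassProblem} (hD : D.IsUpwardClosed)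
    (hne : D.sol.Nonempty) (h : Q.meet R ≤ D.join C) : (D.imp Q).meet (D.imp R) ≤ C := by
  obtain ⟨F, hF, hFC⟩ := h
  obtain ⟨g₀, hg₀⟩ := hne
  obtain ⟨S, T, hS, hT, search⟩ := hF.exists_string_search
  obtain ⟨e, turingPhi_e⟩ := hF.exists_prepend_index
  obtain ⟨K₁, hK₁, eK₁⟩ := hS.exists_cons .oracle
  obtain ⟨K₂, hK₂, eK₂⟩ := (TuringFunctional.of_computable (Computable.const e)).exists_cons hK₁
  obtain ⟨K₃, hK₃, eK₃⟩ := hT.exists_cons hK₂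
  refine ⟨K₃, hK₃, fun k hk => ?_⟩
  have F_total (s : List ℕ) (g : ℕ → ℕ) (hg : g ∈ D.sol) : ∃ f ∈ (Q.meet R).sol,
      F (turingJoin (stringAppend s g) k) = (f : ℕ →. ℕ) :=
    hFC _ ⟨_, hD g hg _ (turingReducible_stringAppend s g), k, hk, rfl⟩
  obtain ⟨s, hs, y, hyT, hy⟩ := search k 0 ⟨stringAppend [] g₀, by
    obtain ⟨f, -, ef⟩ := F_total [] g₀ hg₀
    simp [ef]⟩
  have solves (g : ℕ → ℕ) (hg : g ∈ D.sol) : ∃ f ∈ (Q.meet R).sol, f 0 = y ∧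
      turingPhi e (turingJoin g (stringCons (encode s) k)) = fun n => Part.some (f (n + 1)) := by
    obtain ⟨f, hf, ef⟩ := F_total s g hg
    exact ⟨f, hf, by simpa [ef, eq_comm] using hy g, funext fun n => by simp [turingPhi_e, ef]⟩
  refine ⟨stringCons y (stringCons e (stringCons (encode s) k)), ?_,
    eK₃ _ _ _ hyT (eK₂ _ _ _ (Part.mem_some e) (eK₁ _ _ _ hs rfl))⟩
  obtain ⟨f₀, hf₀, rfl, -⟩ := solves g₀ hg₀
  refine mem_meet_sol_iff.2 ((mem_meet_sol_iff.1 hf₀).imp (fun h₀ => ?_) fun h₀ => ?_)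
  all_goals
    refine ⟨h₀.1, e, _, rfl, fun g hg => ?_⟩
    obtain ⟨f, hf, hf₀, ef⟩ := solves g hg
    refine ⟨_, ?_, ef⟩
    simpa [hf₀, h₀.1] using mem_meet_sol_iff.1 hf

theorem le_univ_iff {A : MassProblem} :
    A ≤ (⟨Set.univ⟩ : MassProblem) ↔ ∃ f ∈ A.sol, Computable f := by
  constructor
  · rintro ⟨F, hF, h⟩
    obtain ⟨f, hf, e⟩ := h (fun _ => 0) trivial
    exact ⟨f, hf, (hF.turingReducible e).partrec_of_const⟩
  · rintro ⟨f, hf, f_computable⟩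
    exact ⟨_, .of_computable f_computable, fun _ _ => ⟨f, hf, rfl⟩⟩

end MassProblem

namespace MedvedevDegree

theorem IsMuchnik.inf_sdiff {d : MedvedevDegree} (hd : d.IsMuchnik) (x y : MedvedevDegree) :
    (x ⊓ y) \ d = x \ d ⊓ y \ d := by
  refine le_antisymm (le_inf (sdiff_le_sdiff_right inf_le_left)
    (sdiff_le_sdiff_right inf_le_right)) ?_
  obtain ⟨D, rfl, hD⟩ := hd
  induction x using ind with
  | h Q =>
  induction y using ind with
  | h R =>
  rcases D.sol.eq_empty_or_nonempty with hempty | hne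
  · have deg_eq_top : deg D = ⊤ :=
      top_unique (MassProblem.le_of_sol_subset (A := ⟨∅⟩) hempty.subset)
    simp [deg_eq_top]
  · exact MassProblem.IsUpwardClosed.meet_imp_le_of_meet_le_join hD hne
      ((MassProblem.imp_le_iff D (Q.meet R) _).1 le_rfl)

theorem eq_bot_or_eq_bot_of_inf_eq_bot {x y : MedvedevDegree} (h : x ⊓ y = ⊥) :
    x = ⊥ ∨ y = ⊥ := by
  induction x using ind with
  | h Q =>
  induction y using ind with
  | h R =>
  have eq_bot_iff_computable (A : MassProblem) : deg A = ⊥ ↔ ∃ f ∈ A.sol, Computable f :=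
    le_bot_iff.symm.trans MassProblem.le_univ_iff
  obtain ⟨f, hf, f_computable⟩ := (eq_bot_iff_computable (Q.meet R)).1 h
  have tail_computable : Computable fun n => f (n + 1) := f_computable.comp Computable.succ
  rcases MassProblem.mem_meet_sol_iff.1 hf with ⟨-, hQ⟩ | ⟨-, hR⟩
  · exact Or.inl ((eq_bot_iff_computable Q).2 ⟨_, hQ, tail_computable⟩)
  · exact Or.inr ((eq_bot_iff_computable R).2 ⟨_, hR, tail_computable⟩)

theorem IsMuchnik.le_or_le_of_inf_le {d : MedvedevDegree} (hd : d.IsMuchnik)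
    {x y : MedvedevDegree} (h : x ⊓ y ≤ d) : x ≤ d ∨ y ≤ d := by
  simp only [← sdiff_eq_bot_iff] at h ⊢
  exact eq_bot_or_eq_bot_of_inf_eq_bot (hd.inf_sdiff x y ▸ h)

end MedvedevDegree

/-! ### Canonical elements of Brouwer algebras -/

section Canonical

variable {L : Type*} [CoheytingAlgebra L] {b d : L}

/-- An element `d` of a Brouwer algebra is canonical if it is meet-prime (`d = ⊤` being allowed) and
`d → x × y = (d → x) × (d → y)` for all `x` and `y`. -/
structure IsCanonical (d : L) : Prop where
  le_or_le_of_inf_le {x y : L} : x ⊓ y ≤ d → x ≤ d ∨ y ≤ d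
  inf_sdiff (x y : L) : (x ⊓ y) \ d = x \ d ⊓ y \ d

namespace Factor

theorem mk_sdiff (b x y : L) : mk b x \ mk b y = mk b ((x ⊓ b) \ y) := rfl

theorem mk_self (b : L) : mk b b = ⊤ := top_unique (mk_le_mk.2 inf_le_right)

theorem top_sdiff_mk (b p : L) : ⊤ \ mk b p = mk b (b \ p) := by
  rw [← mk_self, mk_sdiff, inf_idem]

end Factor

namespace IsCanonical

variable {ι : Type*} {s : Finset ι} {f : ι → L}

theorem exists_le_of_inf'_le (hd : IsCanonical d) (hs : s.Nonempty) (h : s.inf' hs f ≤ d) :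
    ∃ i ∈ s, f i ≤ d := by
  by_contra! hf
  exact Finset.inf'_mem {x | ¬ x ≤ d}
    (fun x hx y hy hxy => (hd.le_or_le_of_inf_le hxy).elim hx hy) s hs f hf h

theorem inf'_sdiff (hd : IsCanonical d) (hs : s.Nonempty) :
    s.inf' hs f \ d = s.inf' hs fun i => f i \ d :=
  Finset.apply_inf'_eq_inf'_comp hs (· \ d) hd.inf_sdiff

theorem factor_mk (hd : IsCanonical d) : IsCanonical (Factor.mk b d) where
  le_or_le_of_inf_le {x y} h := by
    induction x using Factor.ind with
    | h x =>
    induction y using Factor.ind with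
    | h y =>
    have h : (x ⊓ y) ⊓ b ≤ d := Factor.mk_le_mk.1 h
    rw [inf_inf_distrib_right] at h
    exact (hd.le_or_le_of_inf_le h).imp Factor.mk_le_mk.2 Factor.mk_le_mk.2
  inf_sdiff x y := by
    induction x using Factor.ind with
    | h x =>
    induction y using Factor.ind with
    | h y =>
    calc Factor.mk b ((x ⊓ y ⊓ b) \ d)
      _ = Factor.mk b ((x ⊓ b) \ d ⊓ (y ⊓ b) \ d) := by rw [inf_inf_distrib_right, hd.inf_sdiff]

end IsCanonical

theorem MedvedevDegree.IsMuchnik.isCanonical {d : MedvedevDegree} (hd : d.IsMuchnik) :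
    IsCanonical d :=
  ⟨hd.le_or_le_of_inf_le, hd.inf_sdiff⟩

/-- A canonical embedding of one Brouwer algebra into another: an injection with canonical values
that preserves everything except possibly meets. -/
structure IsCanonicalEmbedding {K : Type*} [CoheytingAlgebra K] (a : K → L) : Prop where
  map_top : a ⊤ = ⊤
  map_sup (x y : K) : a (x ⊔ y) = a x ⊔ a y
  map_sdiff (x y : K) : a (x \ y) = a x \ a y
  injective : Function.Injective a
  isCanonical (x : K) : IsCanonical (a x)

namespace IsCanonicalEmbedding

variable {K K' : Type*} [CoheytingAlgebra K] [CoheytingAlgebra K'] {a : K → L}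

theorem comp_coheytingHom (ha : IsCanonicalEmbedding a) {f : CoheytingHom K' K}
    (hf : Function.Injective f) : IsCanonicalEmbedding (a ∘ f) where
  map_top := by simp [ha.map_top]
  map_sup x y := by simp [ha.map_sup]
  map_sdiff x y := by simp [ha.map_sdiff]
  injective := ha.injective.comp hf
  isCanonical x := ha.isCanonical (f x)

theorem le_iff_le (ha : IsCanonicalEmbedding a) {x y : K} : a x ≤ a y ↔ x ≤ y := by
  rw [← sup_eq_right, ← ha.map_sup, ha.injective.eq_iff, sup_eq_right]

end IsCanonicalEmbedding

end Canonical

/-! ### Embedding the algebras of finite problems -/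

namespace MedvedevAlgebra

variable {n : ℕ} {X Y : MedvedevAlgebra n} {s t : Finset (Fin n)}

open Classical in
/-- The elements of the upper set `X` together with `∅`, which form a nonempty simplicial complex
on `Fin n`. -/
noncomputable def simplices (X : MedvedevAlgebra n) : Finset (Finset (Fin n)) :=
  {s | ∀ h : s.Nonempty, OrderDual.toDual ⟨s, h⟩ ∈ X}

theorem mem_simplices :
    s ∈ X.simplices ↔ ∀ h : s.Nonempty, OrderDual.toDual ⟨s, h⟩ ∈ X := by
  simp [simplices]

theorem empty_mem_simplices (X : MedvedevAlgebra n) : ∅ ∈ X.simplices := by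
  simp [mem_simplices]

theorem simplices_nonempty (X : MedvedevAlgebra n) : X.simplices.Nonempty :=
  ⟨∅, X.empty_mem_simplices⟩

theorem mem_simplices_of_subset (ht : t ∈ X.simplices) (hst : s ⊆ t) : s ∈ X.simplices :=
  mem_simplices.2 fun hs => X.upper
    (show OrderDual.toDual (⟨t, hs.mono hst⟩ : {s : Finset (Fin n) // s.Nonempty}) ≤ _ from hst)
    (mem_simplices.1 ht (hs.mono hst))

theorem le_iff_simplices_subset : X ≤ Y ↔ Y.simplices ⊆ X.simplices := by
  refine ⟨fun h s hs => mem_simplices.2 fun hne => h (mem_simplices.1 hs hne), fun h p hp => ?_⟩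
  exact mem_simplices.1 (@h (OrderDual.ofDual p).1 (mem_simplices.2 fun _ => hp)) _

theorem mem_simplices_sup : s ∈ (X ⊔ Y).simplices ↔ s ∈ X.simplices ∧ s ∈ Y.simplices := by
  simp [mem_simplices, forall_and]

theorem mem_simplices_inf : s ∈ (X ⊓ Y).simplices ↔ s ∈ X.simplices ∨ s ∈ Y.simplices := by
  rcases s.eq_empty_or_nonempty with rfl | hs
  · simp [empty_mem_simplices]
  · simp [mem_simplices, hs]

/-- The complex of all `u` such that `u ∩ s` is a simplex of `Y`. -/
def relativize (Y : MedvedevAlgebra n) (s : Finset (Fin n)) : MedvedevAlgebra n where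
  carrier := {p | (OrderDual.ofDual p).1 ∩ s ∈ Y.simplices}
  upper' := fun _ _ h hp => mem_simplices_of_subset hp (Finset.inter_subset_inter_right h)

theorem mem_simplices_relativize {u : Finset (Fin n)} :
    u ∈ (Y.relativize s).simplices ↔ u ∩ s ∈ Y.simplices := by
  rcases u.eq_empty_or_nonempty with rfl | hu
  · simp [empty_mem_simplices]
  · exact mem_simplices.trans ⟨fun h => h hu, fun h _ => h⟩

theorem sdiff_le_sup'_relativize (Y X : MedvedevAlgebra n) :
    Y \ X ≤ X.simplices.sup' X.simplices_nonempty Y.relativize := by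
  rw [sdiff_le_iff, le_iff_simplices_subset]
  intro u hu
  obtain ⟨huX, hu⟩ := mem_simplices_sup.1 hu
  have := le_iff_simplices_subset.1 (Finset.le_sup' Y.relativize huX) hu
  simpa [mem_simplices_relativize] using this

section Eval

variable {L : Type*} [CoheytingAlgebra L] {a : Finset (Fin n) → L}

/-- The extension to `MedvedevAlgebra n` of a canonical embedding `a` of the power set of `Fin n`:
the complex generated by the simplex `s` corresponds to `sᶜ`, and complexes are meets (unions) of
simplices. -/
noncomputable def evalSimplices (a : Finset (Fin n) → L) (X : MedvedevAlgebra n) : L :=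
  X.simplices.inf' X.simplices_nonempty fun s => a sᶜ

theorem evalSimplices_le (hs : s ∈ X.simplices) : evalSimplices a X ≤ a sᶜ :=
  Finset.inf'_le _ hs

theorem evalSimplices_mono (a : Finset (Fin n) → L) : Monotone (evalSimplices a) := fun _ Y h =>
  Finset.inf'_mono _ (le_iff_simplices_subset.1 h) Y.simplices_nonempty

theorem evalSimplices_inf (a : Finset (Fin n) → L) (X Y : MedvedevAlgebra n) :
    evalSimplices a (X ⊓ Y) = evalSimplices a X ⊓ evalSimplices a Y := by
  refine le_antisymm ((evalSimplices_mono a).map_inf_le X Y) (Finset.le_inf' _ _ fun s hs => ?_)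
  exact (mem_simplices_inf.1 hs).elim (fun h => inf_le_left.trans (evalSimplices_le h))
    fun h => inf_le_right.trans (evalSimplices_le h)

theorem evalSimplices_sup (ha : ∀ s t, a (s ⊔ t) = a s ⊔ a t) (X Y : MedvedevAlgebra n) :
    evalSimplices a (X ⊔ Y) = evalSimplices a X ⊔ evalSimplices a Y := by
  refine le_antisymm ?_ ((evalSimplices_mono a).le_map_sup X Y)
  simp only [evalSimplices, Finset.inf'_sup_inf', ← ha]
  refine Finset.le_inf' _ _ fun p hp => ?_
  obtain ⟨hX, hY⟩ := Finset.mem_product.1 hp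
  rw [← compl_inf]
  exact evalSimplices_le (mem_simplices_sup.2 ⟨mem_simplices_of_subset hX Finset.inter_subset_left,
    mem_simplices_of_subset hY Finset.inter_subset_right⟩)

end Eval

end MedvedevAlgebra

namespace IsCanonicalEmbedding

open MedvedevAlgebra

variable {n : ℕ} {L : Type*} [CoheytingAlgebra L] {a : Finset (Fin n) → L}

theorem evalSimplices_top (ha : IsCanonicalEmbedding a) : evalSimplices a ⊤ = ⊤ := by
  refine top_unique (Finset.le_inf' _ _ fun s hs => ?_)
  rcases s.eq_empty_or_nonempty with rfl | hne
  · simpa using ha.map_top.ge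
  · exact (mem_simplices.1 hs hne).elim

theorem evalSimplices_relativize_le (ha : IsCanonicalEmbedding a) (Y : MedvedevAlgebra n)
    (s : Finset (Fin n)) : evalSimplices a (Y.relativize s) ≤ evalSimplices a Y \ a sᶜ := by
  rw [evalSimplices, evalSimplices, (ha.isCanonical sᶜ).inf'_sdiff]
  refine Finset.le_inf' _ _ fun t ht => ?_
  have mem : t ∪ sᶜ ∈ (Y.relativize s).simplices := mem_simplices_relativize.2 <|
    mem_simplices_of_subset ht fun i => by
      simp only [Finset.mem_inter, Finset.mem_union, Finset.mem_compl]
      tauto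
  rw [← ha.map_sdiff, sdiff_eq, ← compl_sup]
  exact evalSimplices_le mem

theorem evalSimplices_sdiff (ha : IsCanonicalEmbedding a) (Y X : MedvedevAlgebra n) :
    evalSimplices a (Y \ X) = evalSimplices a Y \ evalSimplices a X := by
  refine le_antisymm ?_ ?_
  · calc evalSimplices a (Y \ X)
      _ ≤ evalSimplices a (X.simplices.sup' X.simplices_nonempty Y.relativize) :=
        evalSimplices_mono a (sdiff_le_sup'_relativize Y X)
      _ = X.simplices.sup' X.simplices_nonempty (evalSimplices a ∘ Y.relativize) :=
        Finset.apply_sup'_eq_sup'_comp _ _ (evalSimplices_sup ha.map_sup)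
      _ ≤ evalSimplices a Y \ evalSimplices a X := Finset.sup'_le _ _ fun s hs =>
        (ha.evalSimplices_relativize_le Y s).trans (sdiff_le_sdiff_left (evalSimplices_le hs))
  · rw [sdiff_le_iff, ← evalSimplices_sup ha.map_sup]
    exact evalSimplices_mono a le_sup_sdiff

theorem evalSimplices_le_iff (ha : IsCanonicalEmbedding a) {X Y : MedvedevAlgebra n} :
    evalSimplices a X ≤ evalSimplices a Y ↔ X ≤ Y := by
  refine ⟨fun h => le_iff_simplices_subset.2 fun t ht => ?_, fun h => evalSimplices_mono a h⟩
  obtain ⟨s, hs, hst⟩ := (ha.isCanonical tᶜ).exists_le_of_inf'_le _ (h.trans (evalSimplices_le ht))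
  exact mem_simplices_of_subset hs (compl_le_compl_iff_le.1 (ha.le_iff_le.1 hst))

theorem bEmbeddable (ha : IsCanonicalEmbedding a) : BEmbeddable (MedvedevAlgebra n) L := by
  refine ⟨⟨⟨⟨evalSimplices a, evalSimplices_sup ha.map_sup⟩, evalSimplices_inf a⟩,
    ha.evalSimplices_top, ha.evalSimplices_sdiff⟩, fun X Y h => ?_⟩
  exact le_antisymm (ha.evalSimplices_le_iff.1 h.le) (ha.evalSimplices_le_iff.1 h.ge)

end IsCanonicalEmbedding

/-! ### The Muchnik degree of an antichain of Turing degrees -/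

section AvoidCones

variable {ι : Type*} {h : ι → ℕ → ℕ} {S T : Set ι}

/-- The mass problem of avoiding the cones below the `h i` with `i ∈ S`: its solutions are the
functions that are not computable from any of these `h i`. -/
def avoidCones (h : ι → ℕ → ℕ) (S : Set ι) : MassProblem :=
  ⟨{g | ∀ i ∈ S, ¬ TuringReducible (g : ℕ →. ℕ) (h i : ℕ →. ℕ)}⟩

theorem isUpwardClosed_avoidCones (h : ι → ℕ → ℕ) (S : Set ι) :
    (avoidCones h S).IsUpwardClosed :=
  fun _ hf _ hfg i hi hg => hf i hi (hfg.trans hg)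

theorem isMuchnik_avoidCones (h : ι → ℕ → ℕ) (S : Set ι) :
    (MedvedevDegree.deg (avoidCones h S)).IsMuchnik :=
  ⟨_, rfl, isUpwardClosed_avoidCones h S⟩

theorem avoidCones_mono (h : ι → ℕ → ℕ) (hST : S ⊆ T) : avoidCones h S ≤ avoidCones h T :=
  MassProblem.le_of_sol_subset fun _ hg i hi => hg i (hST hi)

theorem deg_avoidCones_sup (h : ι → ℕ → ℕ) (S T : Set ι) :
    MedvedevDegree.deg (avoidCones h S) ⊔ MedvedevDegree.deg (avoidCones h T) =
      MedvedevDegree.deg (avoidCones h (S ∪ T)) := by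
  refine le_antisymm (sup_le (avoidCones_mono h Set.subset_union_left)
    (avoidCones_mono h Set.subset_union_right)) ((isUpwardClosed_avoidCones h _).le_iff.2 ?_)
  rintro _ ⟨f, hf, g, hg, rfl⟩ i (hi | hi) hred
  · exact hf i hi (turingJoin_turingReducible_iff.1 hred).1
  · exact hg i hi (turingJoin_turingReducible_iff.1 hred).2

theorem IsTuringAntichain.avoidCones_le_join_iff (hh : IsTuringAntichain h) {C : MassProblem} :
    avoidCones h T ≤ (avoidCones h S).join C ↔ avoidCones h (T \ S) ≤ C := by
  rw [(isUpwardClosed_avoidCones h _).le_iff, (isUpwardClosed_avoidCones h _).le_iff]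
  constructor
  · rintro hT c hc j ⟨hjT, hjS⟩ hcj
    have hj : h j ∈ (avoidCones h S).sol := fun i hi => hh fun hji => hjS (hji ▸ hi)
    exact hT ⟨h j, hj, c, hc, rfl⟩ j hjT (turingJoin_turingReducible_iff.2 ⟨.refl _, hcj⟩)
  · rintro hT _ ⟨g, hg, c, hc, rfl⟩ j hj hred
    obtain ⟨hgj, hcj⟩ := turingJoin_turingReducible_iff.1 hred
    exact hT hc j ⟨hj, fun hjS => hg j hjS hgj⟩ hcj

theorem IsTuringAntichain.deg_avoidCones_sdiff (hh : IsTuringAntichain h) (T S : Set ι) :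
    MedvedevDegree.deg (avoidCones h T) \ MedvedevDegree.deg (avoidCones h S) =
      MedvedevDegree.deg (avoidCones h (T \ S)) :=
  eq_of_forall_ge_iff <| MedvedevDegree.ind fun _ =>
    sdiff_le_iff.trans hh.avoidCones_le_join_iff

theorem IsTuringAntichain.subset_of_avoidCones_le (hh : IsTuringAntichain h)
    (hST : avoidCones h S ≤ avoidCones h T) : S ⊆ T := by
  intro i hi
  by_contra hiT
  have hmem : h i ∈ (avoidCones h T).sol := fun j hj => hh fun hij => hiT (hij ▸ hj)
  exact (isUpwardClosed_avoidCones h S).le_iff.1 hST hmem i hi (.refl _)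

theorem IsTuringAntichain.isCanonicalEmbedding_avoidCones (hh : IsTuringAntichain h) :
    IsCanonicalEmbedding fun S => Factor.mk (MedvedevDegree.deg (avoidCones h Set.univ))
      (MedvedevDegree.deg (avoidCones h S)) := by
  have inf_univ (S : Set ι) : MedvedevDegree.deg (avoidCones h S) ⊓
      MedvedevDegree.deg (avoidCones h Set.univ) = MedvedevDegree.deg (avoidCones h S) :=
    inf_eq_left.2 (avoidCones_mono h (Set.subset_univ S))
  have le_of_mk_le {S T : Set ι} (hST : Factor.mk (MedvedevDegree.deg (avoidCones h Set.univ))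
      (MedvedevDegree.deg (avoidCones h S)) ≤ Factor.mk _ (MedvedevDegree.deg (avoidCones h T))) :
      S ⊆ T := by
    rw [Factor.mk_le_mk, inf_univ] at hST
    exact hh.subset_of_avoidCones_le hST
  exact
    { map_top := Factor.mk_self _
      map_sup S T := congrArg (Factor.mk _) (deg_avoidCones_sup h S T).symm
      map_sdiff T S := by rw [Factor.mk_sdiff, inf_univ, hh.deg_avoidCones_sdiff]
      injective S T hST := (le_of_mk_le hST.le).antisymm (le_of_mk_le hST.ge)
      isCanonical S := (isMuchnik_avoidCones h S).isCanonical.factor_mk }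

end AvoidCones

/-- The power set of `ℕ` contains that of `Fin n` as the algebra of unions of residue classes
modulo `n`. -/
def residueClassHom (n : ℕ) [NeZero n] : CoheytingHom (Finset (Fin n)) (Set ℕ) where
  toFun s := {i | Fin.ofNat n i ∈ s}
  map_sup' s t := by ext; simp
  map_inf' s t := by ext; simp
  map_top' := by ext; simp
  map_sdiff' s t := by ext; simp

theorem residueClassHom_injective (n : ℕ) [NeZero n] :
    Function.Injective (residueClassHom n) := by
  intro s t hst
  ext i
  have hi : Fin.ofNat n i ∈ s ↔ Fin.ofNat n i ∈ t := Set.ext_iff.1 hst i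
  simpa using hi

theorem IsTuringAntichain.bEmbeddable_medvedevAlgebra {h : ℕ → ℕ → ℕ} (hh : IsTuringAntichain h)
    (n : ℕ) [NeZero n] :
    BEmbeddable (MedvedevAlgebra n) (Factor (MedvedevDegree.deg (avoidCones h Set.univ))) :=
  (hh.isCanonicalEmbedding_avoidCones.comp_coheytingHom (residueClassHom_injective n)).bEmbeddable

/-! ### Theories of Brouwer algebras -/

namespace PropForm

variable {L L' : Type*} [CoheytingAlgebra L] [CoheytingAlgebra L']

theorem eval_subst (σ : ℕ → PropForm) (v : ℕ → L) (φ : PropForm) :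
    (subst σ φ).eval v = φ.eval fun i => (σ i).eval v := by
  induction φ with
  | var i => rfl
  | and φ ψ hφ hψ | or φ ψ hφ hψ | imp φ ψ hφ hψ => simp only [subst, eval, hφ, hψ]
  | neg φ hφ => simp only [subst, eval, hφ]

theorem eval_map (f : CoheytingHom L L') (v : ℕ → L) (φ : PropForm) :
    φ.eval (fun i => f (v i)) = f (φ.eval v) := by
  induction φ with
  | var i => rfl
  | and φ ψ hφ hψ | or φ ψ hφ hψ | imp φ ψ hφ hψ =>
    simp only [eval, hφ, hψ, map_sup, map_inf, map_sdiff]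
  | neg φ hφ => simp only [eval, hφ, map_sdiff, map_top]

theorem Derivable.eval_eq_bot {Γ : Set PropForm} (hΓ : Γ ⊆ BrouwerTheory L) {φ : PropForm}
    (h : Derivable Γ φ) (v : ℕ → L) : φ.eval v = ⊥ := by
  induction h with
  | extra σ hφ => rw [eval_subst, hΓ hφ]
  | mp _ _ himp hφ => simpa only [eval, hφ, sdiff_bot] using himp
  | k => simpa only [eval, sdiff_eq_bot_iff] using sdiff_le
  | s φ ψ χ =>
    simp only [eval, sdiff_eq_bot_iff, sdiff_le_iff]
    have hχ : eval v χ ≤ eval v ψ ⊔ (eval v φ ⊔ (eval v χ \ eval v ψ) \ eval v φ) :=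
      le_sup_sdiff.trans (sup_le_sup_left le_sup_sdiff _)
    have hψ : eval v ψ ≤ eval v φ ⊔ eval v ψ \ eval v φ := le_sup_sdiff
    refine hχ.trans (sup_le (hψ.trans ?_) ?_)
    · exact sup_le_sup_left le_sup_left _
    · exact sup_le_sup_left le_sup_right _
  | and_left => simpa only [eval, sdiff_eq_bot_iff] using le_sup_left
  | and_right => simpa only [eval, sdiff_eq_bot_iff] using le_sup_right
  | and_intro => simp only [eval, sdiff_eq_bot_iff, sdiff_le_iff, sup_comm, le_refl]
  | or_left => simpa only [eval, sdiff_eq_bot_iff] using inf_le_left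
  | or_right => simpa only [eval, sdiff_eq_bot_iff] using inf_le_right
  | or_elim => simp only [eval, sdiff_eq_bot_iff, sdiff_le_iff, sdiff_inf, sup_comm, le_refl]
  | neg_intro φ ψ =>
    simp only [eval, sdiff_eq_bot_iff, sdiff_le_iff]
    have htop : (⊤ : L) ≤ eval v ψ ⊔ (eval v φ ⊔ (⊤ \ eval v ψ) \ eval v φ) :=
      le_sup_sdiff.trans (sup_le_sup_left le_sup_sdiff _)
    have hψ : eval v ψ ≤ eval v φ ⊔ eval v ψ \ eval v φ := le_sup_sdiff
    refine htop.trans (sup_le (hψ.trans ?_) ?_)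
    · exact sup_le_sup_left le_sup_right _
    · exact sup_le_sup_left le_sup_left _
  | neg_elim => simpa only [eval, sdiff_eq_bot_iff] using sdiff_le_sdiff_right le_top

theorem kreiselPutnam_mem_brouwerTheory
    (h : ∀ p x y : L, (x ⊓ y) \ (⊤ \ p) = x \ (⊤ \ p) ⊓ y \ (⊤ \ p)) :
    kreiselPutnam ∈ BrouwerTheory L := fun v => by
  simp only [kreiselPutnam, eval, h, sdiff_self]

end PropForm

theorem BEmbeddable.brouwerTheory_subset {L L' : Type*} [CoheytingAlgebra L] [CoheytingAlgebra L']
    (h : BEmbeddable L L') : BrouwerTheory L' ⊆ BrouwerTheory L := by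
  obtain ⟨f, hf⟩ := h
  intro φ hφ v
  apply hf
  rw [← PropForm.eval_map, hφ, map_bot]

theorem MedvedevDegree.IsMuchnik.logicKP_subset_brouwerTheory {B : MedvedevDegree}
    (hB : B.IsMuchnik) : LogicKP ⊆ BrouwerTheory (Factor B) := by
  intro φ hφ
  refine hφ.eval_eq_bot (Set.singleton_subset_iff.2 ?_)
  refine PropForm.kreiselPutnam_mem_brouwerTheory fun p => ?_
  induction p using Factor.ind with
  | h p =>
    rw [Factor.top_sdiff_mk]
    exact (hB.sdiff p).isCanonical.factor_mk.inf_sdiff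

theorem brouwerTheory_subset_logicLM {L : Type*} [CoheytingAlgebra L]
    (hL : ∀ n : ℕ, 1 ≤ n → BEmbeddable (MedvedevAlgebra n) L) : BrouwerTheory L ⊆ LogicLM :=
  fun _ hφ n hn => (hL n hn).brouwerTheory_subset hφ

theorem corollary5_general :
    (∃ B : MedvedevDegree, B.IsMuchnik ∧
      ∀ n : ℕ, 1 ≤ n → BEmbeddable (MedvedevAlgebra n) (Factor B)) ∧
    (∀ B : MedvedevDegree, B.IsMuchnik → LogicKP ⊆ BrouwerTheory (Factor B)) ∧
    (∀ (L : Type*) [CoheytingAlgebra L],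
      (∀ n : ℕ, 1 ≤ n → BEmbeddable (MedvedevAlgebra n) L) → BrouwerTheory L ⊆ LogicLM) := by
  obtain ⟨h, hh⟩ := exists_isTuringAntichain ℕ
  refine ⟨⟨_, isMuchnik_avoidCones h Set.univ, fun n hn => ?_⟩,
    fun B hB => hB.logicKP_subset_brouwerTheory, fun L _ => brouwerTheory_subset_logicLM⟩
  have : NeZero n := ⟨Nat.one_le_iff_ne_zero.1 hn⟩
  exact hh.bEmbeddable_medvedevAlgebra n

theorem corollary5 :
    (∃ B : MedvedevDegree, B.IsMuchnik ∧
      ∀ n : ℕ, 1 ≤ n → BEmbeddable (MedvedevAlgebra n) (Factor B)) ∧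
    (∀ B : MedvedevDegree, B.IsMuchnik →
      (∀ n : ℕ, 1 ≤ n → BEmbeddable (MedvedevAlgebra n) (Factor B)) →
      LogicKP ⊆ BrouwerTheory (Factor B) ∧ BrouwerTheory (Factor B) ⊆ LogicLM) := by
  obtain ⟨hexists, hKP, hLM⟩ := corollary5_general
  exact ⟨hexists, fun B hB hn => ⟨hKP B hB, hLM _ hn⟩⟩
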